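/- Let $G$ be a Lie group and let $\tau:P\to M$ be a smooth principal $G$-bundle with right action $(u,g)\mapsto u\cdot g$, where all manifolds are real, finite-dimensional, smooth, Hausdorff, second countable and without boundary. Let $$J^1P=\{\rho:T_{\tau(u)}M\to T_uP \text{ linear}\;:\;u\in P,\ T_u\tau\circ\rho=\mathrm{id}\},$$ regarded as an embedded submanifold of the vector bundle $\mathrm{Hom}(\tau^*TM,TP)$ over $P$. The $1$-jet at $x$ of a local section $s$ of $\tau$ is $j^1_xs:=T_xs\in J^1P$, and every element of $J^1P$ is of this form. Put $\tau_{10}(\rho):=u$ for $\rho:T_{\tau(u)}M\to T_uP$ in $J^1P$, so that $\tau_{10}(j^1_xs)=s(x)$. The group $G$ acts on $J^1P$ from the right by $\rho\cdot g:=T_uR_g\circ\rho$, where $R_g(u)=u\cdot g$; let $C(P):=J^1P/G$ be the orbit space with the quotient topology, $p_G:J^1P\to J^1P/G$, $\rho\mapsto[\rho]_G$, the projection, and $p:J^1P/G\to M$, $p([j^1_xs]_G):=x$. Then $J^1P/G$ is a smooth (Hausdorff, second countable) manifold, with the unique smooth structure for which $p_G$ is a submersion; $p_G$ is a principal $G$-bundle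 and $p$ is smooth. Moreover the pullback $$p^*P=\{(c,u)\in J^1P/G\times P\;:\;p(c)=\tau(u)\},$$ an embedded submanifold of $J^1P/G\times P$, with the action $(c,u)\cdot g=(c,u\cdot g)$ and the projection $p_1(c,u)=c$, is a principal $G$-bundle over $J^1P/G$, and the map $$J^1P\to p^*P,\qquad j^1_xs\mapsto\bigl([j^1_xs]_G,\,s(x)\bigr)$$ is an isomorphism of principal $G$-bundles over $J^1P/G$, that is, a $G$-equivariant diffeomorphism covering the identity of $J^1P/G$. -/

import Mathlib

open scoped Manifold ContDiff Bundle Topology RightActions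

noncomputable section

section General

variable {E_B H_B E_X H_X E_G H_G : Type*}
  [NormedAddCommGroup E_B] [NormedSpace ℝ E_B] [TopologicalSpace H_B]
  [NormedAddCommGroup E_X] [NormedSpace ℝ E_X] [TopologicalSpace H_X]
  [NormedAddCommGroup E_G] [NormedSpace ℝ E_G] [TopologicalSpace H_G]
  {B X G : Type*}
  [TopologicalSpace B] [ChartedSpace H_B B] [TopologicalSpace X] [ChartedSpace H_X X]
  [TopologicalSpace G] [ChartedSpace H_G G] [Group G] [MulAction Gᵐᵒᵖ X]

/-- `pr : X → B` is a smooth principal `G`-bundle: `G` acts smoothly on `X` from the right (a right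
action is an action of `Gᵐᵒᵖ`, written `x <• g`), `pr` is smooth and invariant, and over a
neighbourhood `U` of every point of `B` there is an equivariant diffeomorphism
`pr ⁻¹' U ≃ U × G` over `U`. -/
structure IsPrincipalBundle (I_X : ModelWithCorners ℝ E_X H_X) (I_B : ModelWithCorners ℝ E_B H_B)
    (I_G : ModelWithCorners ℝ E_G H_G) (pr : X → B) : Prop where
  contMDiff_act : ContMDiff (I_X.prod I_G) I_X ∞ (fun q : X × G => q.1 <• q.2)
  contMDiff_proj : ContMDiff I_X I_B ∞ pr
  proj_act : ∀ (x : X) (g : G), pr (x <• g) = pr x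
  exists_trivialization : ∀ b : B, ∃ (U : Set B)
    (φ : PartialDiffeomorph I_X (I_B.prod I_G) X (B × G) ∞),
    IsOpen U ∧ b ∈ U ∧ φ.source = pr ⁻¹' U ∧ φ.target = U ×ˢ Set.univ ∧
    (∀ x ∈ φ.source, (φ.toPartialEquiv x).1 = pr x) ∧
    (∀ x ∈ φ.source, ∀ g : G,
      (φ.toPartialEquiv (x <• g)).2 = (φ.toPartialEquiv x).2 * g)

variable {E_Y H_Y Y : Type*} [NormedAddCommGroup E_Y] [NormedSpace ℝ E_Y] [TopologicalSpace H_Y]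
  [TopologicalSpace Y] [ChartedSpace H_Y Y]

/-- `f : X → Y` is an isomorphism from the principal `G`-bundle `pr : X → B` to the principal
`G`-bundle `pr' : Y → B`: a `G`-equivariant diffeomorphism covering the identity of `B`. -/
structure IsPrincipalBundleIso (G : Type*) [Group G] [MulAction Gᵐᵒᵖ X] [MulAction Gᵐᵒᵖ Y]
    (I_X : ModelWithCorners ℝ E_X H_X) (I_Y : ModelWithCorners ℝ E_Y H_Y)
    (pr : X → B) (pr' : Y → B) (f : X → Y) : Prop where
  diffeomorph : ∃ Φ : Diffeomorph I_X I_Y X Y ∞, ⇑Φ = f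
  proj_comp : ∀ x, pr' (f x) = pr x
  map_act : ∀ (x : X) (g : G), f (x <• g) = f x <• g

end General

/-- A smooth principal `G`-bundle `P → M`; the manifolds `M`, `G`, `P` (without boundary) are
modelled on the vector spaces `E_M`, `E_G`, `E_P`. -/
structure PrincipalBundle (E_M E_G E_P M G P : Type*)
    [NormedAddCommGroup E_M] [NormedSpace ℝ E_M] [NormedAddCommGroup E_G] [NormedSpace ℝ E_G]
    [NormedAddCommGroup E_P] [NormedSpace ℝ E_P]
    [TopologicalSpace M] [ChartedSpace E_M M] [TopologicalSpace G] [ChartedSpace E_G G]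
    [TopologicalSpace P] [ChartedSpace E_P P] [Group G] [MulAction Gᵐᵒᵖ P] where
  /-- The bundle projection `τ : P → M`. -/
  proj : C^∞⟮𝓘(ℝ, E_P), P; 𝓘(ℝ, E_M), M⟯
  isPrincipalBundle : IsPrincipalBundle (G := G) 𝓘(ℝ, E_P) 𝓘(ℝ, E_M) 𝓘(ℝ, E_G) proj

namespace PrincipalBundle

variable {E_M E_G E_P M G P : Type*}
  [NormedAddCommGroup E_M] [NormedSpace ℝ E_M] [NormedAddCommGroup E_G] [NormedSpace ℝ E_G]
  [NormedAddCommGroup E_P] [NormedSpace ℝ E_P]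
  [TopologicalSpace M] [ChartedSpace E_M M] [IsManifold 𝓘(ℝ, E_M) ∞ M]
  [TopologicalSpace G] [ChartedSpace E_G G] [Group G]
  [TopologicalSpace P] [ChartedSpace E_P P] [IsManifold 𝓘(ℝ, E_P) ∞ P] [MulAction Gᵐᵒᵖ P]
  (B : PrincipalBundle E_M E_G E_P M G P)

/-- The fibre `T_{τ(p)}M` of `τ^*TM` is an additive group. -/
instance (p : P) : AddCommGroup ((B.proj *ᵖ (TangentSpace 𝓘(ℝ, E_M) : M → Type _)) p) :=
  inferInstanceAs (AddCommGroup (TangentSpace 𝓘(ℝ, E_M) (B.proj p)))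

/-- The total space of the vector bundle `Hom(τ^*TM, TP) → P`: pairs of a point `p : P` and a
linear map `T_{τ(p)}M → T_pP`. It carries Mathlib's topology and smooth structure of a
Hom-bundle. -/
abbrev HomBundle : Type _ :=
  Bundle.TotalSpace (E_M →L[ℝ] E_P)
    (fun p : P => (B.proj *ᵖ (TangentSpace 𝓘(ℝ, E_M) : M → Type _)) p →L[ℝ]
      (TangentSpace 𝓘(ℝ, E_P) p : Type _))

/-- The derivative `T_pτ : T_pP → T_{τ(p)}M`. -/
def tangentProj (p : P) : TangentSpace 𝓘(ℝ, E_P) p →L[ℝ] TangentSpace 𝓘(ℝ, E_M) (B.proj p) :=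
  mfderiv 𝓘(ℝ, E_P) 𝓘(ℝ, E_M) B.proj p

/-- The first jet space `J¹P`: linear maps `ρ : T_{τ(p)}M → T_pP` with `T_pτ ∘ ρ = id`, as a
subset of `Hom(τ^*TM, TP)` (with the subspace topology). -/
def J1 : Type _ :=
  {ρ : B.HomBundle // ∀ v : TangentSpace 𝓘(ℝ, E_M) (B.proj ρ.1), B.tangentProj ρ.1 (ρ.2 v) = v}

instance : TopologicalSpace B.J1 :=
  inferInstanceAs (TopologicalSpace {ρ : B.HomBundle //
    ∀ v : TangentSpace 𝓘(ℝ, E_M) (B.proj ρ.1), B.tangentProj ρ.1 (ρ.2 v) = v})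

/-- The inclusion `J¹P ⊆ Hom(τ^*TM, TP)`. -/
def incl (ρ : B.J1) : B.HomBundle := ρ.1

/-- `τ₁₀ : J¹P → P`. -/
def tau10 (ρ : B.J1) : P := (B.incl ρ).1

/-- `τ₁ : J¹P → M`. -/
def tau1 (ρ : B.J1) : M := B.proj (B.tau10 ρ)

/-- The push-forward `ρ ↦ T_pf ∘ ρ` of jets by a fibre-preserving smooth map `f : P → P`. Here
`T_{τ(p)}M` and `T_{τ(f(p))}M` are the same space, as `τ(f(p)) = τ(p)`. -/
def mapJet (f : P → P) (hf : ContMDiff 𝓘(ℝ, E_P) 𝓘(ℝ, E_P) ∞ f)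
    (hproj : ∀ p, B.proj (f p) = B.proj p) (ρ : B.J1) : B.J1 :=
  ⟨⟨f (B.tau10 ρ), ((mfderiv 𝓘(ℝ, E_P) 𝓘(ℝ, E_P) f (B.tau10 ρ) : E_P →L[ℝ] E_P).comp
      ((B.incl ρ).2 : E_M →L[ℝ] E_P) : E_M →L[ℝ] E_P)⟩, by
    intro v
    have h1 : mfderiv 𝓘(ℝ, E_P) 𝓘(ℝ, E_M) (fun q => B.proj (f q)) (B.tau10 ρ) =
        (mfderiv 𝓘(ℝ, E_P) 𝓘(ℝ, E_M) B.proj (f (B.tau10 ρ))).comp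
          (mfderiv 𝓘(ℝ, E_P) 𝓘(ℝ, E_P) f (B.tau10 ρ)) :=
      mfderiv_comp (B.tau10 ρ) (B.proj.contMDiff.mdifferentiable (by simp) _)
        (hf.mdifferentiable (by simp) _)
    have h2 : (fun q => B.proj (f q)) = B.proj := funext hproj
    have h3 := ρ.2 v
    have h4 : (mfderiv 𝓘(ℝ, E_P) 𝓘(ℝ, E_M) (fun q => B.proj (f q)) (B.tau10 ρ) : E_P →L[ℝ] E_M) =
        (mfderiv 𝓘(ℝ, E_P) 𝓘(ℝ, E_M) B.proj (B.tau10 ρ) : E_P →L[ℝ] E_M) := by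
      rw [h2]
    have h5 := congrArg (fun L : E_P →L[ℝ] E_M => L ((B.incl ρ).2 v)) (h1.symm.trans h4)
    exact h5.trans h3⟩

theorem contMDiff_translate (B : PrincipalBundle E_M E_G E_P M G P) (g : G) :
    ContMDiff 𝓘(ℝ, E_P) 𝓘(ℝ, E_P) ∞ (fun p : P => p <• g) :=
  B.isPrincipalBundle.contMDiff_act.comp (contMDiff_id.prodMk contMDiff_const)

theorem mapJet_congr {f f' : P → P} (h : f = f') (hf) (hproj) (hf') (hproj') (ρ : B.J1) :
    B.mapJet f hf hproj ρ = B.mapJet f' hf' hproj' ρ := by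
  subst h; rfl

theorem mapJet_id (hf) (hproj) (ρ : B.J1) : B.mapJet id hf hproj ρ = ρ := by
  apply Subtype.ext
  have : (mfderiv 𝓘(ℝ, E_P) 𝓘(ℝ, E_P) (id : P → P) (B.tau10 ρ) : E_P →L[ℝ] E_P) =
    ContinuousLinearMap.id ℝ E_P := mfderiv_id
  unfold mapJet
  simp only [this]
  rfl

theorem mapJet_comp {f f' : P → P} (hf) (hproj) (hf') (hproj') (hff) (hpp) (ρ : B.J1) :
    B.mapJet (f' ∘ f) hff hpp ρ = B.mapJet f' hf' hproj' (B.mapJet f hf hproj ρ) := by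
  apply Subtype.ext
  have : (mfderiv 𝓘(ℝ, E_P) 𝓘(ℝ, E_P) (f' ∘ f) (B.tau10 ρ) : E_P →L[ℝ] E_P) =
      (mfderiv 𝓘(ℝ, E_P) 𝓘(ℝ, E_P) f' (f (B.tau10 ρ)) : E_P →L[ℝ] E_P).comp
        (mfderiv 𝓘(ℝ, E_P) 𝓘(ℝ, E_P) f (B.tau10 ρ) : E_P →L[ℝ] E_P) :=
    mfderiv_comp (B.tau10 ρ) (hf'.mdifferentiable (by simp) _) (hf.mdifferentiable (by simp) _)
  unfold mapJet
  simp only [this]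
  rfl

/-- The lift of the right `G`-action to `J¹P`: `ρ · g = T_pR_g ∘ ρ`, where `R_g(p) = p · g`. -/
instance : MulAction Gᵐᵒᵖ B.J1 where
  smul a ρ := B.mapJet (fun p => p <• a.unop) (B.contMDiff_translate a.unop)
    (fun p => B.isPrincipalBundle.proj_act p a.unop) ρ
  one_smul ρ := (B.mapJet_congr (funext fun p => one_smul Gᵐᵒᵖ p) _ _ contMDiff_id
    (fun _ => rfl) ρ).trans (B.mapJet_id _ _ ρ)
  mul_smul a b ρ := (B.mapJet_congr (funext fun p => mul_smul a b p) _ _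
    ((B.contMDiff_translate a.unop).comp (B.contMDiff_translate b.unop))
    (fun p => (B.isPrincipalBundle.proj_act _ a.unop).trans
      (B.isPrincipalBundle.proj_act p b.unop)) ρ).trans (B.mapJet_comp _ _ _ _ _ _ ρ)

theorem tau10_act (ρ : B.J1) (g : G) : B.tau10 (ρ <• g) = B.tau10 ρ <• g := rfl

theorem tau1_act (ρ : B.J1) (g : G) : B.tau1 (ρ <• g) = B.tau1 ρ :=
  B.isPrincipalBundle.proj_act (B.tau10 ρ) g

/-- The orbit space `C(P) = J¹P/G` (with the quotient topology), the bundle of connections. -/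
def C : Type _ := Quotient (MulAction.orbitRel Gᵐᵒᵖ B.J1)

instance : TopologicalSpace B.C :=
  inferInstanceAs (TopologicalSpace (Quotient (MulAction.orbitRel Gᵐᵒᵖ B.J1)))

/-- The orbit projection `p_G : J¹P → J¹P/G`, `ρ ↦ [ρ]_G`. -/
def toC (ρ : B.J1) : B.C := Quotient.mk (MulAction.orbitRel Gᵐᵒᵖ B.J1) ρ

/-- The projection `p : J¹P/G → M`, `[ρ]_G ↦ τ₁(ρ)`. -/
def projC : B.C → M :=
  Quotient.lift B.tau1 (by
    rintro _ ρ ⟨a, rfl⟩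
    exact B.tau1_act ρ a.unop)

/-- The pullback bundle `p^*P = {(c, u) ∈ J¹P/G × P : p(c) = τ(u)}` (with the subspace topology of
the product). -/
def Pullback : Type _ := {q : B.C × P // B.projC q.1 = B.proj q.2}

instance : TopologicalSpace B.Pullback :=
  inferInstanceAs (TopologicalSpace {q : B.C × P // B.projC q.1 = B.proj q.2})

/-- The inclusion `p^*P ⊆ J¹P/G × P`. -/
def pullbackIncl (q : B.Pullback) : B.C × P := q.1

/-- The projection `p₁ : p^*P → J¹P/G`. -/
def pullbackProj (q : B.Pullback) : B.C := (B.pullbackIncl q).1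

/-- The right `G`-action on `p^*P`: `(c, u) · g = (c, u · g)`. -/
instance : MulAction Gᵐᵒᵖ B.Pullback where
  smul a q := ⟨(q.1.1, q.1.2 <• a.unop),
    q.2.trans (B.isPrincipalBundle.proj_act q.1.2 a.unop).symm⟩
  one_smul q := Subtype.ext (Prod.ext rfl (one_smul Gᵐᵒᵖ q.1.2))
  mul_smul a b q := Subtype.ext (Prod.ext rfl (mul_smul a b q.1.2))

/-- The map `J¹P → p^*P`, `ρ ↦ ([ρ]_G, τ₁₀(ρ))`. -/
def toPullback (ρ : B.J1) : B.Pullback := ⟨(B.toC ρ, B.tau10 ρ), rfl⟩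

/-- `s` is a smooth section of `τ : P → M` on a neighbourhood of `x`. -/
def IsLocalSectionAt (s : M → P) (x : M) : Prop :=
  ∃ U : Set M, IsOpen U ∧ x ∈ U ∧ ContMDiffOn 𝓘(ℝ, E_M) 𝓘(ℝ, E_P) ∞ s U ∧
    ∀ y ∈ U, B.proj (s y) = y

/-- The `1`-jet `j¹_x s` of a local section `s` at `x`, that is the derivative
`T_xs : T_xM → T_{s(x)}P`, where `x = τ(s(x))`. -/
def jet (s : M → P) (x : M) (hs : B.IsLocalSectionAt s x) : B.J1 :=
  ⟨⟨s x, (mfderiv 𝓘(ℝ, E_M) 𝓘(ℝ, E_P) s x : E_M →L[ℝ] E_P)⟩, by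
    obtain ⟨U, hU, hx, hs, hsec⟩ := hs
    intro v
    have hd : MDifferentiableAt 𝓘(ℝ, E_M) 𝓘(ℝ, E_P) s x :=
      (hs.contMDiffAt (hU.mem_nhds hx)).mdifferentiableAt (by simp)
    have h1 : mfderiv 𝓘(ℝ, E_M) 𝓘(ℝ, E_M) (fun y => B.proj (s y)) x =
        (mfderiv 𝓘(ℝ, E_P) 𝓘(ℝ, E_M) B.proj (s x)).comp
          (mfderiv 𝓘(ℝ, E_M) 𝓘(ℝ, E_P) s x) :=
      mfderiv_comp x (B.proj.contMDiff.mdifferentiable (by simp) _) hd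
    have h2 : (fun y => B.proj (s y)) =ᶠ[𝓝 x] id :=
      Filter.eventually_of_mem (hU.mem_nhds hx) hsec
    have h3 : (mfderiv 𝓘(ℝ, E_M) 𝓘(ℝ, E_M) (fun y => B.proj (s y)) x : E_M →L[ℝ] E_M) =
        ContinuousLinearMap.id ℝ E_M :=
      h2.mfderiv_eq.trans mfderiv_id
    exact congrArg (fun L : E_M →L[ℝ] E_M => L v) (h1.symm.trans h3)⟩

/-- The model vector space of `J¹P` and of `p^*P`: in a chart of `M` and a trivialization of `P`,
`J¹P` has coordinates `(x, g, A)` with `A : T_xM → T_gG`. -/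
abbrev ModelJ1 (E_M E_G : Type*) [NormedAddCommGroup E_M] [NormedSpace ℝ E_M]
    [NormedAddCommGroup E_G] [NormedSpace ℝ E_G] : Type _ :=
  E_M × E_G × (E_M →L[ℝ] E_G)

/-- The model vector space of `J¹P/G`. -/
abbrev ModelC (E_M E_G : Type*) [NormedAddCommGroup E_M] [NormedSpace ℝ E_M]
    [NormedAddCommGroup E_G] [NormedSpace ℝ E_G] : Type _ :=
  E_M × (E_M →L[ℝ] E_G)

/-- The given atlases define the standard smooth structures: `J¹P` is an embedded submanifold of
`Hom(τ^*TM, TP)`, `J¹P/G` is the quotient manifold (`p_G` is a submersion onto it), and `p^*P` is an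
embedded submanifold of `J¹P/G × P`. Each of these properties determines the smooth structure
uniquely. -/
structure IsStandardSmoothStructure [ChartedSpace (ModelJ1 E_M E_G) B.J1]
    [ChartedSpace (ModelC E_M E_G) B.C] [ChartedSpace (ModelJ1 E_M E_G) B.Pullback] : Prop where
  isManifold_J1 : IsManifold 𝓘(ℝ, ModelJ1 E_M E_G) ∞ B.J1
  isManifold_C : IsManifold 𝓘(ℝ, ModelC E_M E_G) ∞ B.C
  isManifold_pullback : IsManifold 𝓘(ℝ, ModelJ1 E_M E_G) ∞ B.Pullback
  isSmoothEmbedding_incl : Manifold.IsSmoothEmbedding 𝓘(ℝ, ModelJ1 E_M E_G)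
    (𝓘(ℝ, E_P).prod 𝓘(ℝ, E_M →L[ℝ] E_P)) ∞ B.incl
  isSubmersion_toC : Manifold.IsSubmersion 𝓘(ℝ, ModelJ1 E_M E_G) 𝓘(ℝ, ModelC E_M E_G) ∞ B.toC
  isSmoothEmbedding_pullbackIncl : Manifold.IsSmoothEmbedding 𝓘(ℝ, ModelJ1 E_M E_G)
    (𝓘(ℝ, ModelC E_M E_G).prod 𝓘(ℝ, E_P)) ∞ B.pullbackIncl

end PrincipalBundle

end

/-!
A smooth local trivialization of `P` turns every `G`-equivariant map `X → P` into a gauge: each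
orbit near a given one contains exactly one point whose fibre coordinate is the unit of `G`. Hence
`X → X/G` is a principal bundle as soon as it has smooth local sections, and an equivariant smooth
map over the identity between two principal bundles is automatically a diffeomorphism. Both are
applied to `J¹P → P`, `ρ ↦ τ₁₀(ρ)`, and to `p^*P → P`, `(c, u) ↦ u`: the two spaces are principal
bundles over `J¹P/G`, and `J¹P → p^*P` is an equivariant map between them.

The smooth structures come from slice charts. In charts of `P` and `M` in which `τ` is the first
projection, an element of `Hom(τ^*TM, TP)` is a pair of a point and a linear map `A`, and it lies
in `J¹P` if and only if the first component of `A` is the identity. In the same charts `p^*P` is the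
zero set of the difference of the two base coordinates.
-/

noncomputable section

open Bundle Function Manifold Set Topology

section PartialDiffeomorphisms

variable {E F E' F' H H' X Y : Type*}
  [NormedAddCommGroup E] [NormedSpace ℝ E] [NormedAddCommGroup E'] [NormedSpace ℝ E']
  [NormedAddCommGroup F] [NormedSpace ℝ F] [NormedAddCommGroup F'] [NormedSpace ℝ F']
  [TopologicalSpace H] [TopologicalSpace H']
  {I : ModelWithCorners ℝ E H} {J : ModelWithCorners ℝ E' H'}
  [TopologicalSpace X] [ChartedSpace H X] [TopologicalSpace Y] [ChartedSpace H' Y]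
  {n : WithTop ℕ∞} (Φ : PartialDiffeomorph I J X Y n)

theorem contMDiffAt_of_mem_source {x : X} (hx : x ∈ Φ.source) : ContMDiffAt I J n Φ x :=
  Φ.contMDiffOn.contMDiffAt (Φ.open_source.mem_nhds hx)

theorem contMDiffAt_symm_of_mem_target {y : Y} (hy : y ∈ Φ.target) :
    ContMDiffAt J I n Φ.symm y :=
  contMDiffAt_of_mem_source Φ.symm hy

theorem mfderiv_symm_comp_mfderiv_of_mem_source (hn : n ≠ 0) {x : X} (hx : x ∈ Φ.source) :
    (mfderiv J I Φ.symm (Φ x) : E' →L[ℝ] E) ∘L (mfderiv I J Φ x : E →L[ℝ] E') =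
      ContinuousLinearMap.id ℝ E := by
  have hchain := mfderiv_comp x
    ((contMDiffAt_symm_of_mem_target Φ (Φ.map_source hx)).mdifferentiableAt hn)
    ((contMDiffAt_of_mem_source Φ hx).mdifferentiableAt hn)
  have hid : Φ.symm ∘ Φ =ᶠ[𝓝 x] id :=
    Filter.eventually_of_mem (Φ.open_source.mem_nhds hx) fun y hy => Φ.left_inv hy
  exact hchain.symm.trans (hid.mfderiv_eq.trans mfderiv_id)

theorem mfderiv_comp_mfderiv_symm_of_mem_target (hn : n ≠ 0) {y : Y} (hy : y ∈ Φ.target) :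
    (mfderiv I J Φ (Φ.symm y) : E →L[ℝ] E') ∘L (mfderiv J I Φ.symm y : E' →L[ℝ] E) =
      ContinuousLinearMap.id ℝ E' :=
  mfderiv_symm_comp_mfderiv_of_mem_source Φ.symm hn hy

theorem mfderiv_comp_mfderiv_symm_of_mem_source (hn : n ≠ 0) {x : X} (hx : x ∈ Φ.source) :
    (mfderiv I J Φ x : E →L[ℝ] E') ∘L (mfderiv J I Φ.symm (Φ x) : E' →L[ℝ] E) =
      ContinuousLinearMap.id ℝ E' := by
  have h := mfderiv_comp_mfderiv_symm_of_mem_target Φ hn (Φ.map_source hx)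
  rwa [show Φ.symm (Φ x) = x from Φ.left_inv hx] at h

/-- The preferred chart at a point, as a partial diffeomorphism onto an open subset of the model
vector space. -/
def chartDiffeomorph [IsManifold I n X] [I.Boundaryless] (x : X) :
    PartialDiffeomorph I 𝓘(ℝ, E) X E n where
  toPartialEquiv := extChartAt I x
  open_source := isOpen_extChartAt_source x
  open_target := isOpen_extChartAt_target x
  contMDiffOn_toFun := by
    rw [extChartAt_source]
    exact contMDiffOn_extChartAt
  contMDiffOn_invFun := contMDiffOn_extChartAt_symm x

/-- The product of two partial diffeomorphisms to vector spaces; the target `F × F'` carries the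
smooth structure of a vector space, not that of a product of manifolds. -/
def prodSpace (Φ : PartialDiffeomorph I 𝓘(ℝ, F) X F n) (Ψ : PartialDiffeomorph J 𝓘(ℝ, F') Y F' n) :
    PartialDiffeomorph (I.prod J) 𝓘(ℝ, F × F') (X × Y) (F × F') n where
  toPartialEquiv := Φ.toPartialEquiv.prod Ψ.toPartialEquiv
  open_source := Φ.open_source.prod Ψ.open_source
  open_target := Φ.open_target.prod Ψ.open_target
  contMDiffOn_toFun := (Φ.contMDiffOn.comp contMDiffOn_fst fun _ h => h.1).prodMk_space
    (Ψ.contMDiffOn.comp contMDiffOn_snd fun _ h => h.2)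
  contMDiffOn_invFun :=
    (Φ.symm.contMDiffOn.comp contDiff_fst.contMDiff.contMDiffOn fun _ h => h.1).prodMk
      (Ψ.symm.contMDiffOn.comp contDiff_snd.contMDiff.contMDiffOn fun _ h => h.2)

/-- The shear `(a, v) ↦ (a, v - f a)` over an open subset `O` of a vector space; it straightens the
graph of `f` to the slice `v = 0`. -/
def shear {O : Set F} (hO : IsOpen O) {f : F → F'} (hf : ContDiffOn ℝ n f O) :
    PartialDiffeomorph 𝓘(ℝ, F × F') 𝓘(ℝ, F × F') (F × F') (F × F') n where
  toFun p := (p.1, p.2 - f p.1)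
  invFun p := (p.1, p.2 + f p.1)
  source := O ×ˢ univ
  target := O ×ˢ univ
  map_source' _ hp := hp
  map_target' _ hp := hp
  left_inv' p _ := Prod.ext rfl (sub_add_cancel p.2 (f p.1))
  right_inv' p _ := Prod.ext rfl (add_sub_cancel_right p.2 (f p.1))
  open_source := hO.prod isOpen_univ
  open_target := hO.prod isOpen_univ
  contMDiffOn_toFun := (contDiffOn_fst.prodMk
    (contDiffOn_snd.sub (hf.comp contDiffOn_fst fun _ hp => hp.1))).contMDiffOn
  contMDiffOn_invFun := (contDiffOn_fst.prodMk
    (contDiffOn_snd.add (hf.comp contDiffOn_fst fun _ hp => hp.1))).contMDiffOn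

end PartialDiffeomorphisms

section ModelCharts

variable {E F H X : Type*} [NormedAddCommGroup E] [NormedSpace ℝ E]
  [NormedAddCommGroup F] [NormedSpace ℝ F] [TopologicalSpace H]
  {I : ModelWithCorners ℝ E H} [I.Boundaryless] [TopologicalSpace X] [ChartedSpace H X]
  {n : WithTop ℕ∞} (Φ : PartialDiffeomorph I 𝓘(ℝ, F) X F n) (L : F ≃L[ℝ] E)

/-- A partial diffeomorphism onto an open subset of a vector space `F`, turned by a linear
isomorphism of `F` with the model vector space into a chart of the manifold. -/
def modelChart : OpenPartialHomeomorph X H :=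
  Φ.toOpenPartialHomeomorph.transHomeomorph (L.toHomeomorph.trans I.toHomeomorph.symm)

theorem modelChart_extend_apply (x : X) : (modelChart Φ L).extend I x = L (Φ x) :=
  I.toHomeomorph.apply_symm_apply (L (Φ x))

theorem modelChart_extend_symm_apply (v : E) :
    ((modelChart Φ L).extend I).symm v = Φ.symm (L.symm v) :=
  congrArg (fun w => Φ.symm (L.symm w)) (I.toHomeomorph.apply_symm_apply v)

theorem modelChart_extend_target : ((modelChart Φ L).extend I).target = L.symm ⁻¹' Φ.target := by
  ext v
  rw [OpenPartialHomeomorph.extend_target, I.range_eq_univ, inter_univ]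
  change L.symm (I (I.symm v)) ∈ Φ.target ↔ _
  rw [I.right_inv (by simp only [I.range_eq_univ, mem_univ])]
  rfl

theorem modelChart_mem_maximalAtlas [IsManifold I n X] :
    modelChart Φ L ∈ IsManifold.maximalAtlas I n X := by
  apply OpenPartialHomeomorph.mem_maximalAtlas_of_contMDiffOn
  · have hI : ContMDiffOn 𝓘(ℝ, E) I n I.symm univ := I.range_eq_univ ▸ I.contMDiffOn_symm
    exact hI.comp (L.contDiff.contMDiff.comp_contMDiffOn Φ.contMDiffOn) fun _ _ => mem_univ _
  · exact Φ.symm.contMDiffOn.comp (L.symm.contDiff.contMDiff.comp I.contMDiff).contMDiffOn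
      fun _ hx => hx

end ModelCharts

section SubmersionsAndEmbeddings

variable {E E' E'' H H' H'' X Y Z : Type*}
  [NormedAddCommGroup E] [NormedSpace ℝ E] [TopologicalSpace H]
  [NormedAddCommGroup E'] [NormedSpace ℝ E'] [TopologicalSpace H']
  [NormedAddCommGroup E''] [NormedSpace ℝ E''] [TopologicalSpace H'']
  {I : ModelWithCorners ℝ E H} {J : ModelWithCorners ℝ E' H'} {K : ModelWithCorners ℝ E'' H''}
  [TopologicalSpace X] [ChartedSpace H X] [TopologicalSpace Y] [ChartedSpace H' Y]
  [TopologicalSpace Z] [ChartedSpace H'' Z] {n : WithTop ℕ∞}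

theorem exists_localSection_of_isSubmersionAt [I.Boundaryless] {q : X → Y} {x : X}
    (hq : IsSubmersionAt I J n q x) :
    ∃ σ : Y → X, ContMDiffAt J I n σ (q x) ∧ σ (q x) = x ∧ ∀ᶠ y in 𝓝 (q x), q (σ y) = y := by
  let d := hq.domChart
  let c := hq.codChart
  have hxd : x ∈ d.source := hq.mem_domChart_source
  have hxc : q x ∈ c.source := hq.mem_codChart_source
  have hdx : d.extend I x ∈ (d.extend I).target :=
    (d.extend I).map_source (by rwa [d.extend_source])
  have hq_chart : ∀ v ∈ (d.extend I).target,
      c.extend J (q ((d.extend I).symm v)) = (hq.equiv v).1 := fun v hv => hq.writtenInCharts hv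
  -- In the charts of the submersion `q` is `(a, b) ↦ a`, so freeze `b` at its value at `x`.
  let w : Y → E := fun y => hq.equiv.symm (c.extend J y, (hq.equiv (d.extend I x)).2)
  have hwx : w (q x) = d.extend I x := by
    have h := hq_chart _ hdx
    rw [d.extend_left_inv hxd] at h
    exact (ContinuousLinearEquiv.symm_apply_eq _).2 (Prod.ext h rfl)
  have hw : ContMDiffAt J 𝓘(ℝ, E) n w (q x) :=
    hq.equiv.symm.contDiff.contMDiff.contMDiffAt.comp _
      ((c.contMDiffAt_extend hq.codChart_mem_maximalAtlas hxc).prodMk_space contMDiffAt_const)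
  have htarget : (d.extend I).target ∈ 𝓝 (w (q x)) := hwx ▸ d.isOpen_extend_target.mem_nhds hdx
  have hdsymm : ContMDiffAt 𝓘(ℝ, E) I n (d.extend I).symm (w (q x)) := by
    have h := contMDiffOn_extend_symm (I := I) hq.domChart_mem_maximalAtlas
    rw [I.image_eq, ← OpenPartialHomeomorph.extend_target] at h
    exact h.contMDiffAt htarget
  refine ⟨fun y => (d.extend I).symm (w y), hdsymm.comp _ hw, ?_, ?_⟩
  · exact (congrArg (d.extend I).symm hwx).trans (d.extend_left_inv hxd)
  filter_upwards [hw.continuousAt.eventually htarget, c.open_source.mem_nhds hxc] with y hy hyc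
  have hsource : (d.extend I).symm (w y) ∈ d.source := by
    simpa only [d.extend_source] using (d.extend I).map_target hy
  rw [← c.extend_source (I := J)] at hyc
  refine (c.extend J).injOn ?_ hyc ((hq_chart _ hy).trans ?_)
  · rw [c.extend_source]
    exact hq.source_subset_preimage_source hsource
  rw [ContinuousLinearEquiv.apply_symm_apply]

theorem contMDiffAt_of_comp_isSubmersionAt [I.Boundaryless] {q : X → Y} {x : X} {f : Y → Z}
    (hq : IsSubmersionAt I J n q x) (hf : ContMDiffAt I K n (f ∘ q) x) :
    ContMDiffAt J K n f (q x) := by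
  obtain ⟨σ, hσ, hσx, hqσ⟩ := exists_localSection_of_isSubmersionAt hq
  have h : ContMDiffAt J K n ((f ∘ q) ∘ σ) (q x) := ContMDiffAt.comp _ (by rwa [hσx]) hσ
  exact h.congr_of_eventuallyEq (hqσ.mono fun y hy => congrArg f hy.symm)

theorem contMDiffAt_iff_comp_isSmoothEmbedding {i : Y → Z} (hi : IsSmoothEmbedding J K n i)
    {f : X → Y} {x : X} : ContMDiffAt I J n f x ↔ ContMDiffAt I K n (i ∘ f) x := by
  rw [ContMDiffAt.iff_comp_isImmersionAt (hi.isImmersion.isImmersionAt (f x))]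
  exact ⟨And.right, fun h => ⟨hi.isEmbedding.isInducing.continuousAt_iff.2 h.continuousAt, h⟩⟩

theorem contMDiff_iff_comp_isSmoothEmbedding {i : Y → Z} (hi : IsSmoothEmbedding J K n i)
    {f : X → Y} : ContMDiff I J n f ↔ ContMDiff I K n (i ∘ f) :=
  forall_congr' fun _ => contMDiffAt_iff_comp_isSmoothEmbedding hi

end SubmersionsAndEmbeddings

section ChartedSpaces

variable {X A : Type*} [TopologicalSpace X]

/-- The charted space structure given by a family of charts, one around each point. -/
abbrev chartedSpaceOfCharts [TopologicalSpace A] (e : X → OpenPartialHomeomorph X A)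
    (he : ∀ x, x ∈ (e x).source) : ChartedSpace A X where
  atlas := range e
  chartAt := e
  mem_chart_source := he
  chart_mem_atlas := mem_range_self

theorem isManifold_chartedSpaceOfCharts [NormedAddCommGroup A] [NormedSpace ℝ A] {n : WithTop ℕ∞}
    {e : X → OpenPartialHomeomorph X A} (he : ∀ x, x ∈ (e x).source)
    (h : ∀ x y, ContDiffOn ℝ n ((e x).symm ≫ₕ e y) ((e x).symm ≫ₕ e y).source) :
    letI := chartedSpaceOfCharts e he
    IsManifold 𝓘(ℝ, A) n X := by
  let _ := chartedSpaceOfCharts e he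
  apply isManifold_of_contDiffOn
  rintro _ _ ⟨x, rfl⟩ ⟨y, rfl⟩
  simpa only [mfld_simps] using h x y

end ChartedSpaces

section SliceCharts

variable {E H X A K S : Type*}
  [NormedAddCommGroup E] [NormedSpace ℝ E] [TopologicalSpace H] {I : ModelWithCorners ℝ E H}
  [TopologicalSpace X] [ChartedSpace H X]
  [NormedAddCommGroup A] [NormedSpace ℝ A] [NormedAddCommGroup K] [NormedSpace ℝ K]
  {n : WithTop ℕ∞}

/-- `Ψ` is a slice chart for the image of `i : S → X`: in the coordinates `Ψ` it is `A × {0}`. -/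
def IsSliceChart (Ψ : PartialDiffeomorph I 𝓘(ℝ, A × K) X (A × K) n) (i : S → X) : Prop :=
  ∀ x ∈ Ψ.source, x ∈ range i ↔ (Ψ x).2 = 0

namespace IsSliceChart

variable {Ψ Ψ' : PartialDiffeomorph I 𝓘(ℝ, A × K) X (A × K) n} {i : S → X}

theorem apply_eq (hΨ : IsSliceChart Ψ i) {s : S} (hs : i s ∈ Ψ.source) :
    Ψ (i s) = ((Ψ (i s)).1, 0) :=
  Prod.ext rfl ((hΨ _ hs).1 (mem_range_self s))

theorem symm_mem_range (hΨ : IsSliceChart Ψ i) {a : A} (ha : (a, 0) ∈ Ψ.target) :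
    Ψ.symm (a, 0) ∈ range i :=
  (hΨ _ (Ψ.map_target ha)).2 (congrArg Prod.snd (Ψ.right_inv ha))

theorem apply_invFun (hΨ : IsSliceChart Ψ i) [Nonempty S] {a : A} (ha : (a, 0) ∈ Ψ.target) :
    i (invFun i (Ψ.symm (a, 0))) = Ψ.symm (a, 0) :=
  invFun_eq (hΨ.symm_mem_range ha)

variable [TopologicalSpace S]

/-- The chart of a subspace induced by a slice chart of the ambient manifold. -/
def chart [Nonempty S] (hΨ : IsSliceChart Ψ i) (hi : IsEmbedding i) :
    OpenPartialHomeomorph S A where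
  toFun s := (Ψ (i s)).1
  invFun a := invFun i (Ψ.symm (a, 0))
  source := i ⁻¹' Ψ.source
  target := {a | (a, 0) ∈ Ψ.target}
  map_source' s hs := by
    rw [mem_ofPred_eq, ← hΨ.apply_eq hs]
    exact Ψ.map_source hs
  map_target' a ha := by
    rw [mem_preimage, hΨ.apply_invFun ha]
    exact Ψ.map_target ha
  left_inv' s hs := by
    rw [← hΨ.apply_eq hs, show Ψ.symm (Ψ (i s)) = i s from Ψ.left_inv hs]
    exact leftInverse_invFun hi.injective s
  right_inv' a ha := by
    rw [hΨ.apply_invFun ha]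
    exact congrArg Prod.fst (Ψ.right_inv ha)
  open_source := Ψ.open_source.preimage hi.continuous
  open_target := Ψ.open_target.preimage (Continuous.prodMk_left 0)
  continuousOn_toFun := continuous_fst.comp_continuousOn
    (Ψ.contMDiffOn.continuousOn.comp hi.continuous.continuousOn fun _ hs => hs)
  continuousOn_invFun := by
    rw [hi.isInducing.continuousOn_iff]
    exact (Ψ.symm.contMDiffOn.continuousOn.comp (Continuous.prodMk_left 0).continuousOn
      fun _ ha => ha).congr fun _ ha => hΨ.apply_invFun ha

theorem contDiffOn_chart_transition [Nonempty S] (hΨ : IsSliceChart Ψ i)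
    (hΨ' : IsSliceChart Ψ' i) (hi : IsEmbedding i) :
    ContDiffOn ℝ n ((hΨ.chart hi).symm ≫ₕ hΨ'.chart hi)
      ((hΨ.chart hi).symm ≫ₕ hΨ'.chart hi).source := by
  apply ContMDiffOn.contDiffOn
  have hsource : ∀ a ∈ ((hΨ.chart hi).symm ≫ₕ hΨ'.chart hi).source,
      (a, 0) ∈ Ψ.target ∧ Ψ.symm (a, 0) ∈ Ψ'.source := fun a ha =>
    ⟨ha.1, hΨ.apply_invFun ha.1 ▸ ha.2⟩
  have hzero : ContMDiff 𝓘(ℝ, A) 𝓘(ℝ, A × K) n fun a : A => (a, (0 : K)) :=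
    (contDiff_prodMk_left 0).contMDiff
  have hsmooth : ContMDiffOn 𝓘(ℝ, A) 𝓘(ℝ, A) n (fun a => (Ψ' (Ψ.symm (a, 0))).1)
      ((hΨ.chart hi).symm ≫ₕ hΨ'.chart hi).source :=
    contDiff_fst.contMDiff.comp_contMDiffOn (Ψ'.contMDiffOn.comp
      (Ψ.symm.contMDiffOn.comp hzero.contMDiffOn fun a ha => (hsource a ha).1)
      fun a ha => (hsource a ha).2)
  exact hsmooth.congr fun a ha => congrArg (fun x => (Ψ' x).1) (hΨ.apply_invFun (hsource a ha).1)

end IsSliceChart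

theorem exists_isSmoothEmbedding_of_isSliceChart [TopologicalSpace S] [I.Boundaryless]
    [IsManifold I n X] (hn : n ≠ 0) {i : S → X} (hi : IsEmbedding i)
    (h : ∀ s, ∃ Ψ : PartialDiffeomorph I 𝓘(ℝ, A × K) X (A × K) n,
      i s ∈ Ψ.source ∧ IsSliceChart Ψ i) :
    ∃ _ : ChartedSpace A S, IsManifold 𝓘(ℝ, A) n S ∧ IsSmoothEmbedding 𝓘(ℝ, A) I n i := by
  choose Ψ hs hΨ using h
  let e (s : S) : OpenPartialHomeomorph S A := haveI : Nonempty S := ⟨s⟩; (hΨ s).chart hi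
  let _ : ChartedSpace A S := chartedSpaceOfCharts e hs
  have hS : IsManifold 𝓘(ℝ, A) n S := isManifold_chartedSpaceOfCharts hs fun s s' =>
    haveI : Nonempty S := ⟨s⟩; (hΨ s).contDiffOn_chart_transition (hΨ s') hi
  refine ⟨inferInstance, hS, ?_, hi⟩
  suffices IsImmersionOfComplement K 𝓘(ℝ, A) I n i from this.isImmersion
  intro s
  have : Nonempty S := ⟨s⟩
  let L : (A × K) ≃L[ℝ] E :=
    (((Ψ s).isLocalDiffeomorphAt I 𝓘(ℝ, A × K) n (hs s)).mfderivToContinuousLinearEquiv hn).symm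
  refine IsImmersionAtOfComplement.mk_of_charts L (e s) (modelChart (Ψ s) L) (hs s) (hs s)
    (IsManifold.chart_mem_maximalAtlas s) (modelChart_mem_maximalAtlas (Ψ s) L)
    (fun _ hs' => hs') fun a ha => ?_
  have ha : (a, (0 : K)) ∈ (Ψ s).target :=
    show a ∈ (e s).target by simpa only [mfld_simps] using ha
  calc (modelChart (Ψ s) L).extend I (i (invFun i ((Ψ s).symm (a, 0))))
      = L (Ψ s (i (invFun i ((Ψ s).symm (a, 0))))) := modelChart_extend_apply _ _ _
    _ = L (Ψ s ((Ψ s).symm (a, 0))) := by rw [(hΨ s).apply_invFun ha]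
    _ = L (a, 0) := congrArg L ((Ψ s).right_inv ha)

end SliceCharts

section EquivariantCharts

variable {E H X E_A H_A A E_G H_G G : Type*}
  [NormedAddCommGroup E] [NormedSpace ℝ E] [TopologicalSpace H] {I : ModelWithCorners ℝ E H}
  [TopologicalSpace X] [ChartedSpace H X]
  [NormedAddCommGroup E_A] [NormedSpace ℝ E_A] [TopologicalSpace H_A]
  {I_A : ModelWithCorners ℝ E_A H_A} [TopologicalSpace A] [ChartedSpace H_A A]
  [NormedAddCommGroup E_G] [NormedSpace ℝ E_G] [TopologicalSpace H_G]
  {I_G : ModelWithCorners ℝ E_G H_G} [TopologicalSpace G] [ChartedSpace H_G G]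
  [Group G] [MulAction Gᵐᵒᵖ X] {n : WithTop ℕ∞}

/-- `Θ` is an equivariant partial diffeomorphism from `X` to `A × G`, defined on an invariant open
set; `G` acts on `A × G` by right multiplication on the second factor. -/
structure IsEquivariantChart (Θ : PartialDiffeomorph I (I_A.prod I_G) X (A × G) n) : Prop where
  act_mem : ∀ x ∈ Θ.source, ∀ g : G, x <• g ∈ Θ.source
  map_act : ∀ x ∈ Θ.source, ∀ g : G, Θ (x <• g) = ((Θ x).1, (Θ x).2 * g)

namespace IsEquivariantChart

variable {Θ : PartialDiffeomorph I (I_A.prod I_G) X (A × G) n} (hΘ : IsEquivariantChart Θ)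
include hΘ

theorem fst_eq_iff {x y : X} (hx : x ∈ Θ.source) (hy : y ∈ Θ.source) :
    (Θ x).1 = (Θ y).1 ↔ ∃ g : G, x <• g = y := by
  constructor
  · intro h
    refine ⟨(Θ x).2⁻¹ * (Θ y).2, Θ.injOn (hΘ.act_mem x hx _) hy ((hΘ.map_act x hx _).trans ?_)⟩
    exact Prod.ext h (mul_inv_cancel_left _ _)
  · rintro ⟨g, rfl⟩
    rw [hΘ.map_act x hx g]

theorem mk_mem_target {a : A} {g : G} (ha : (a, g) ∈ Θ.target) (h : G) : (a, h) ∈ Θ.target := by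
  have hx : Θ.symm (a, g) ∈ Θ.source := Θ.map_target ha
  have hact := Θ.map_source (hΘ.act_mem _ hx (g⁻¹ * h))
  rwa [hΘ.map_act _ hx, show Θ (Θ.symm (a, g)) = (a, g) from Θ.right_inv ha,
    mul_inv_cancel_left] at hact

end IsEquivariantChart

end EquivariantCharts

section OrbitSpaces

variable {E H X A E_G H_G G Y : Type*}
  [NormedAddCommGroup E] [NormedSpace ℝ E] [TopologicalSpace H] {I : ModelWithCorners ℝ E H}
  [TopologicalSpace X] [ChartedSpace H X] [NormedAddCommGroup A] [NormedSpace ℝ A]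
  [NormedAddCommGroup E_G] [NormedSpace ℝ E_G] [TopologicalSpace H_G]
  {I_G : ModelWithCorners ℝ E_G H_G} [TopologicalSpace G] [ChartedSpace H_G G]
  [Group G] [MulAction Gᵐᵒᵖ X] {n : WithTop ℕ∞} {q : X → Y}

namespace IsEquivariantChart

variable {Θ Θ' : PartialDiffeomorph I (𝓘(ℝ, A).prod I_G) X (A × G) n}

theorem surjInv_mem_source (hΘ : IsEquivariantChart Θ) (hq : Surjective q)
    (horb : ∀ x y, q x = q y ↔ ∃ g : G, x <• g = y) {x : X} (hx : x ∈ Θ.source) :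
    surjInv hq (q x) ∈ Θ.source := by
  obtain ⟨g, hg⟩ := (horb x _).1 (surjInv_eq hq (q x)).symm
  exact hg ▸ hΘ.act_mem x hx g

theorem fst_surjInv (hΘ : IsEquivariantChart Θ) (hq : Surjective q)
    (horb : ∀ x y, q x = q y ↔ ∃ g : G, x <• g = y) {x : X} (hx : x ∈ Θ.source) :
    (Θ (surjInv hq (q x))).1 = (Θ x).1 :=
  (hΘ.fst_eq_iff (hΘ.surjInv_mem_source hq horb hx) hx).2 ((horb _ _).1 (surjInv_eq hq (q x)))

variable [TopologicalSpace Y]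

/-- The chart of the orbit space induced by an equivariant chart: the orbit of `x` has the
coordinate `(Θ x).1`. -/
def quotientChart (hΘ : IsEquivariantChart Θ) (hq : IsOpenQuotientMap q)
    (horb : ∀ x y, q x = q y ↔ ∃ g : G, x <• g = y) : OpenPartialHomeomorph Y A where
  toFun y := (Θ (surjInv hq.surjective y)).1
  invFun a := q (Θ.symm (a, 1))
  source := q '' Θ.source
  target := {a | (a, 1) ∈ Θ.target}
  map_source' := by
    rintro _ ⟨x, hx, rfl⟩
    rw [hΘ.fst_surjInv hq.surjective horb hx]
    exact hΘ.mk_mem_target (Θ.map_source hx) 1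
  map_target' _ ha := mem_image_of_mem q (Θ.map_target ha)
  left_inv' := by
    rintro _ ⟨x, hx, rfl⟩
    rw [hΘ.fst_surjInv hq.surjective horb hx]
    have hmem : ((Θ x).1, (1 : G)) ∈ Θ.target := hΘ.mk_mem_target (Θ.map_source hx) 1
    exact (horb _ _).2 ((hΘ.fst_eq_iff (Θ.map_target hmem) hx).1
      (congrArg Prod.fst (Θ.right_inv hmem) :))
  right_inv' a ha := (hΘ.fst_surjInv hq.surjective horb (Θ.map_target ha)).trans
    (congrArg Prod.fst (Θ.right_inv ha))
  open_source := hq.isOpenMap _ Θ.open_source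
  open_target := Θ.open_target.preimage (Continuous.prodMk_left 1)
  continuousOn_toFun := by
    rintro _ ⟨x, hx, rfl⟩
    apply ContinuousAt.continuousWithinAt
    have hfst : ContinuousAt (fun z => (Θ z).1) x :=
      (contMDiffAt_of_mem_source Θ hx).continuousAt.fst
    rw [ContinuousAt, ← hq.map_nhds_eq, Filter.tendsto_map'_iff,
      hΘ.fst_surjInv hq.surjective horb hx]
    exact hfst.tendsto.congr' (Filter.eventually_of_mem (Θ.open_source.mem_nhds hx)
      fun z hz => (hΘ.fst_surjInv hq.surjective horb hz).symm)
  continuousOn_invFun := hq.continuous.comp_continuousOn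
    (Θ.symm.contMDiffOn.continuousOn.comp (Continuous.prodMk_left 1).continuousOn fun _ ha => ha)

variable (hq : IsOpenQuotientMap q) (horb : ∀ x y, q x = q y ↔ ∃ g : G, x <• g = y)

theorem mem_source_of_mem_quotientChart_source (hΘ : IsEquivariantChart Θ) {x : X}
    (hx : q x ∈ (hΘ.quotientChart hq horb).source) : x ∈ Θ.source := by
  obtain ⟨y, hy, hyx⟩ := hx
  obtain ⟨g, rfl⟩ := (horb y x).1 hyx
  exact hΘ.act_mem y hy g

theorem quotientChart_apply (hΘ : IsEquivariantChart Θ) {x : X} (hx : x ∈ Θ.source) :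
    hΘ.quotientChart hq horb (q x) = (Θ x).1 :=
  hΘ.fst_surjInv hq.surjective horb hx

theorem contDiffOn_quotientChart_transition (hΘ : IsEquivariantChart Θ)
    (hΘ' : IsEquivariantChart Θ') :
    ContDiffOn ℝ n ((hΘ.quotientChart hq horb).symm ≫ₕ hΘ'.quotientChart hq horb)
      ((hΘ.quotientChart hq horb).symm ≫ₕ hΘ'.quotientChart hq horb).source := by
  apply ContMDiffOn.contDiffOn
  have hsource : ∀ a ∈ ((hΘ.quotientChart hq horb).symm ≫ₕ hΘ'.quotientChart hq horb).source,
      (a, 1) ∈ Θ.target ∧ Θ.symm (a, 1) ∈ Θ'.source := fun a ha =>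
    ⟨ha.1, hΘ'.mem_source_of_mem_quotientChart_source hq horb ha.2⟩
  have hsmooth : ContMDiffOn 𝓘(ℝ, A) 𝓘(ℝ, A) n (fun a => (Θ' (Θ.symm (a, 1))).1)
      ((hΘ.quotientChart hq horb).symm ≫ₕ hΘ'.quotientChart hq horb).source :=
    contMDiff_fst.comp_contMDiffOn (Θ'.contMDiffOn.comp
      (Θ.symm.contMDiffOn.comp (contMDiff_id.prodMk contMDiff_const).contMDiffOn
        fun a ha => (hsource a ha).1) fun a ha => (hsource a ha).2)
  exact hsmooth.congr fun a ha => hΘ'.quotientChart_apply hq horb (hsource a ha).2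

end IsEquivariantChart

theorem exists_isSubmersion_of_isEquivariantChart [TopologicalSpace Y] [I.Boundaryless]
    [I_G.Boundaryless] [IsManifold I n X] [IsManifold I_G n G] (hn : n ≠ 0)
    (hq : IsOpenQuotientMap q)
    (horb : ∀ x y, q x = q y ↔ ∃ g : G, x <• g = y)
    (h : ∀ x : X, ∃ Θ : PartialDiffeomorph I (𝓘(ℝ, A).prod I_G) X (A × G) n,
      x ∈ Θ.source ∧ IsEquivariantChart Θ) :
    ∃ _ : ChartedSpace A Y, IsManifold 𝓘(ℝ, A) n Y ∧ IsSubmersion I 𝓘(ℝ, A) n q := by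
  choose Θ hx hΘ using h
  let r : Y → X := surjInv hq.surjective
  let e (y : Y) : OpenPartialHomeomorph Y A := (hΘ (r y)).quotientChart hq horb
  have he (y : Y) : y ∈ (e y).source := ⟨r y, hx (r y), surjInv_eq hq.surjective y⟩
  let _ : ChartedSpace A Y := chartedSpaceOfCharts e he
  have hY : IsManifold 𝓘(ℝ, A) n Y := isManifold_chartedSpaceOfCharts he fun y y' =>
    (hΘ (r y)).contDiffOn_quotientChart_transition hq horb (hΘ (r y'))
  refine ⟨inferInstance, hY, ?_⟩
  suffices IsSubmersionOfComplement E_G I 𝓘(ℝ, A) n q from this.isSubmersion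
  intro x
  have hxΘ : x ∈ (Θ (r (q x))).source :=
    (hΘ (r (q x))).mem_source_of_mem_quotientChart_source hq horb (he (q x))
  let Φ := (Θ (r (q x))).trans
    (prodSpace (Diffeomorph.refl 𝓘(ℝ, A) A n).toPartialDiffeomorph
      (chartDiffeomorph (I := I_G) (Θ (r (q x)) x).2))
  have hxΦ : x ∈ Φ.source := ⟨hxΘ, mem_univ _, mem_extChartAt_source _⟩
  let L : E ≃L[ℝ] A × E_G :=
    (Φ.isLocalDiffeomorphAt I 𝓘(ℝ, A × E_G) n hxΦ).mfderivToContinuousLinearEquiv hn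
  refine IsSubmersionAtOfComplement.mk_of_charts L (modelChart Φ L.symm) (e (q x)) hxΦ
    (he (q x)) (modelChart_mem_maximalAtlas Φ L.symm) (IsManifold.chart_mem_maximalAtlas (q x))
    (fun z hz => mem_image_of_mem q hz.1) fun v hv => ?_
  rw [modelChart_extend_target] at hv
  have hz : Φ.symm (L v) ∈ Φ.source := Φ.map_target hv
  calc e (q x) (q (((modelChart Φ L.symm).extend I).symm v))
      = e (q x) (q (Φ.symm (L v))) := by rw [modelChart_extend_symm_apply]; rfl
    _ = (Θ (r (q x)) (Φ.symm (L v))).1 := (hΘ _).quotientChart_apply hq horb hz.1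
    _ = (L v).1 := congrArg Prod.fst (Φ.right_inv hv)

end OrbitSpaces

section RightActions

variable {G X : Type*} [Group G] [MulAction Gᵐᵒᵖ X]

theorem act_one (x : X) : x <• (1 : G) = x := by
  rw [MulOpposite.op_one, one_smul]

theorem act_act (x : X) (a b : G) : (x <• a) <• b = x <• (a * b) := by
  rw [MulOpposite.op_mul, mul_smul]

/-- The representative of the orbit of `x` on which an equivariant map `γ` to `G` is `1`. -/
def gaugeFix (γ : X → G) (x : X) : X := x <• (γ x)⁻¹

theorem gaugeFix_act_self (γ : X → G) (x : X) : gaugeFix γ x <• γ x = x := by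
  rw [gaugeFix, act_act, inv_mul_cancel, act_one]

theorem gaugeFix_eq_self {γ : X → G} {x : X} (h : γ x = 1) : gaugeFix γ x = x := by
  rw [gaugeFix, h, inv_one, act_one]

end RightActions

section Gauges

variable {E H X E' H' X' E_A H_A A E_G H_G G : Type*}
  [NormedAddCommGroup E] [NormedSpace ℝ E] [TopologicalSpace H] {I : ModelWithCorners ℝ E H}
  [TopologicalSpace X] [ChartedSpace H X]
  [NormedAddCommGroup E'] [NormedSpace ℝ E'] [TopologicalSpace H'] {I' : ModelWithCorners ℝ E' H'}
  [TopologicalSpace X'] [ChartedSpace H' X']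
  [NormedAddCommGroup E_A] [NormedSpace ℝ E_A] [TopologicalSpace H_A]
  {I_A : ModelWithCorners ℝ E_A H_A} [TopologicalSpace A] [ChartedSpace H_A A]
  [NormedAddCommGroup E_G] [NormedSpace ℝ E_G] [TopologicalSpace H_G]
  {I_G : ModelWithCorners ℝ E_G H_G} [TopologicalSpace G] [ChartedSpace H_G G]
  [Group G] [MulAction Gᵐᵒᵖ X] [MulAction Gᵐᵒᵖ X'] {n : WithTop ℕ∞}

/-- `γ : X → G` is a gauge over `W`: `W` is an invariant open subset of `X`, and `γ` is smooth and
equivariant there. A gauge singles out the representative `gaugeFix γ x` of each orbit in `W`. -/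
structure IsGauge (I : ModelWithCorners ℝ E H) (I_G : ModelWithCorners ℝ E_G H_G)
    (n : WithTop ℕ∞) (W : Set X) (γ : X → G) : Prop where
  isOpen : IsOpen W
  contMDiffOn : ContMDiffOn I I_G n γ W
  act_mem : ∀ x ∈ W, ∀ g : G, x <• g ∈ W
  map_act : ∀ x ∈ W, ∀ g : G, γ (x <• g) = γ x * g

namespace IsGauge

variable {W : Set X} {γ : X → G} (hγ : IsGauge I I_G n W γ) {x : X}
include hγ

theorem apply_gaugeFix (hx : x ∈ W) : γ (gaugeFix γ x) = 1 := by
  rw [gaugeFix, hγ.map_act x hx, mul_inv_cancel]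

theorem gaugeFix_act (hx : x ∈ W) (g : G) : gaugeFix γ (x <• g) = gaugeFix γ x := by
  rw [gaugeFix, hγ.map_act x hx, act_act, mul_inv_rev, mul_inv_cancel_left, gaugeFix]

theorem contMDiffAt (hx : x ∈ W) : ContMDiffAt I I_G n γ x :=
  hγ.contMDiffOn.contMDiffAt (hγ.isOpen.mem_nhds hx)

theorem contMDiffOn_gaugeFix [LieGroup I_G n G]
    (hact : ContMDiff (I.prod I_G) I n fun p : X × G => p.1 <• p.2) :
    ContMDiffOn I I n (gaugeFix γ) W :=
  hact.comp_contMDiffOn (contMDiffOn_id.prodMk hγ.contMDiffOn.inv)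

theorem comp {t : X' → X} (ht : ContMDiff I' I n t)
    (hact : ∀ (x : X') (g : G), t (x <• g) = t x <• g) : IsGauge I' I_G n (t ⁻¹' W) (γ ∘ t) where
  isOpen := hγ.isOpen.preimage ht.continuous
  contMDiffOn := hγ.contMDiffOn.comp ht.contMDiffOn fun _ hx => hx
  act_mem x hx g := by
    rw [mem_preimage, hact]
    exact hγ.act_mem _ hx g
  map_act x hx g := by
    rw [comp_apply, hact]
    exact hγ.map_act _ hx g

theorem apply_gaugeFix_eq_mk_one {Ψ : PartialDiffeomorph I (I_A.prod I_G) X (A × G) n}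
    (hΨ : ∀ x ∈ Ψ.source, (Ψ x).2 = γ x) (hx : x ∈ W) (hxΨ : gaugeFix γ x ∈ Ψ.source) :
    Ψ (gaugeFix γ x) = ((Ψ (gaugeFix γ x)).1, 1) :=
  Prod.ext rfl ((hΨ _ hxΨ).trans (hγ.apply_gaugeFix hx))

omit hγ [MulAction Gᵐᵒᵖ X] in
theorem apply_symm_mk_one {Ψ : PartialDiffeomorph I (I_A.prod I_G) X (A × G) n}
    (hΨ : ∀ x ∈ Ψ.source, (Ψ x).2 = γ x) {a : A} (ha : (a, 1) ∈ Ψ.target) :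
    γ (Ψ.symm (a, 1)) = 1 :=
  (hΨ _ (Ψ.map_target ha)).symm.trans (congrArg Prod.snd (Ψ.right_inv ha))

omit hγ in
/-- The equivariant chart obtained from a chart `Ψ` of `X` with values in `A × G` whose second
component is the gauge `γ`: its coordinates are the `A`-component of `Ψ` at the gauge-fixed
representative, and the gauge. -/
def equivariantChart [LieGroup I_G n G] (hγ : IsGauge I I_G n W γ)
    (hact : ContMDiff (I.prod I_G) I n fun p : X × G => p.1 <• p.2)
    (Ψ : PartialDiffeomorph I (I_A.prod I_G) X (A × G) n) (hW : Ψ.source ⊆ W)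
    (hΨ : ∀ x ∈ Ψ.source, (Ψ x).2 = γ x) : PartialDiffeomorph I (I_A.prod I_G) X (A × G) n where
  toFun x := ((Ψ (gaugeFix γ x)).1, γ x)
  invFun p := Ψ.symm (p.1, 1) <• p.2
  source := W ∩ gaugeFix γ ⁻¹' Ψ.source
  target := {p | (p.1, 1) ∈ Ψ.target}
  map_source' x hx := by
    rw [mem_ofPred_eq, ← hγ.apply_gaugeFix_eq_mk_one hΨ hx.1 hx.2]
    exact Ψ.map_source hx.2
  map_target' p hp := by
    have hx : Ψ.symm (p.1, 1) ∈ Ψ.source := Ψ.map_target hp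
    refine ⟨hγ.act_mem _ (hW hx) _, ?_⟩
    rwa [mem_preimage, hγ.gaugeFix_act (hW hx), gaugeFix_eq_self (apply_symm_mk_one hΨ hp)]
  left_inv' x hx := by
    rw [← hγ.apply_gaugeFix_eq_mk_one hΨ hx.1 hx.2,
      show Ψ.symm (Ψ (gaugeFix γ x)) = gaugeFix γ x from Ψ.left_inv hx.2, gaugeFix_act_self]
  right_inv' p hp := by
    have hx : Ψ.symm (p.1, 1) ∈ Ψ.source := Ψ.map_target hp
    rw [hγ.gaugeFix_act (hW hx), gaugeFix_eq_self (apply_symm_mk_one hΨ hp), hγ.map_act _ (hW hx),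
      apply_symm_mk_one hΨ hp, one_mul,
      show Ψ (Ψ.symm (p.1, 1)) = (p.1, 1) from Ψ.right_inv hp]
  open_source := (hγ.contMDiffOn_gaugeFix hact).continuousOn.isOpen_inter_preimage hγ.isOpen
    Ψ.open_source
  open_target := Ψ.open_target.preimage (by fun_prop)
  contMDiffOn_toFun := (contMDiff_fst.comp_contMDiffOn (Ψ.contMDiffOn.comp
    ((hγ.contMDiffOn_gaugeFix hact).mono inter_subset_left) fun _ hx => hx.2)).prodMk
    (hγ.contMDiffOn.mono inter_subset_left)
  contMDiffOn_invFun := hact.comp_contMDiffOn ((Ψ.symm.contMDiffOn.comp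
    (contMDiff_fst.prodMk contMDiff_const).contMDiffOn fun _ hp => hp).prodMk contMDiffOn_snd)

omit hγ in
theorem isEquivariantChart_equivariantChart [LieGroup I_G n G] (hγ : IsGauge I I_G n W γ)
    (hact : ContMDiff (I.prod I_G) I n fun p : X × G => p.1 <• p.2)
    (Ψ : PartialDiffeomorph I (I_A.prod I_G) X (A × G) n) (hW : Ψ.source ⊆ W)
    (hΨ : ∀ x ∈ Ψ.source, (Ψ x).2 = γ x) :
    IsEquivariantChart (hγ.equivariantChart hact Ψ hW hΨ) where
  act_mem x hx g := by
    refine ⟨hγ.act_mem x hx.1 g, ?_⟩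
    rw [mem_preimage, hγ.gaugeFix_act hx.1]
    exact hx.2
  map_act x hx g := Prod.ext (congrArg (fun z => (Ψ z).1) (hγ.gaugeFix_act hx.1 g))
    (hγ.map_act x hx.1 g)

end IsGauge

end Gauges

section PrincipalBundles

variable {E_B H_B B E_X H_X X E_G H_G G : Type*}
  [NormedAddCommGroup E_B] [NormedSpace ℝ E_B] [TopologicalSpace H_B]
  {I_B : ModelWithCorners ℝ E_B H_B} [TopologicalSpace B] [ChartedSpace H_B B]
  [NormedAddCommGroup E_X] [NormedSpace ℝ E_X] [TopologicalSpace H_X]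
  {I_X : ModelWithCorners ℝ E_X H_X} [TopologicalSpace X] [ChartedSpace H_X X]
  [NormedAddCommGroup E_G] [NormedSpace ℝ E_G] [TopologicalSpace H_G]
  {I_G : ModelWithCorners ℝ E_G H_G} [TopologicalSpace G] [ChartedSpace H_G G]
  [Group G] [MulAction Gᵐᵒᵖ X]

/-- `φ` is an equivariant local trivialization of `pr : X → B` over the open set `U`. -/
structure IsTrivialization (pr : X → B) (U : Set B)
    (φ : PartialDiffeomorph I_X (I_B.prod I_G) X (B × G) ∞) : Prop where
  isOpen : IsOpen U
  source_eq : φ.source = pr ⁻¹' U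
  target_eq : φ.target = U ×ˢ univ
  fst_eq : ∀ x ∈ φ.source, (φ x).1 = pr x
  snd_act : ∀ x ∈ φ.source, ∀ g : G, (φ (x <• g)).2 = (φ x).2 * g

namespace IsTrivialization

variable {pr : X → B} {U : Set B} {φ : PartialDiffeomorph I_X (I_B.prod I_G) X (B × G) ∞}
  (hφ : IsTrivialization pr U φ)
include hφ

theorem mem_source {x : X} : x ∈ φ.source ↔ pr x ∈ U := by
  rw [hφ.source_eq, mem_preimage]

theorem mk_mem_target {b : B} (hb : b ∈ U) (g : G) : (b, g) ∈ φ.target :=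
  hφ.target_eq ▸ ⟨hb, mem_univ g⟩

theorem proj_symm {b : B} (hb : b ∈ U) (g : G) : pr (φ.symm (b, g)) = b := by
  have hmem := hφ.mk_mem_target hb g
  exact (hφ.fst_eq _ (φ.map_target hmem)).symm.trans (congrArg Prod.fst (φ.right_inv hmem))

end IsTrivialization

namespace IsPrincipalBundle

variable {pr : X → B} (h : IsPrincipalBundle (G := G) I_X I_B I_G pr)
include h

theorem exists_isTrivialization (b : B) :
    ∃ (U : Set B) (φ : PartialDiffeomorph I_X (I_B.prod I_G) X (B × G) ∞),
      b ∈ U ∧ IsTrivialization pr U φ := by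
  obtain ⟨U, φ, hU, hb, hsource, htarget, hfst, hsnd⟩ := h.exists_trivialization b
  exact ⟨U, φ, hb, hU, hsource, htarget, hfst, hsnd⟩

theorem isEquivariantChart {U : Set B} {φ : PartialDiffeomorph I_X (I_B.prod I_G) X (B × G) ∞}
    (hφ : IsTrivialization pr U φ) : IsEquivariantChart φ := by
  have hact : ∀ x ∈ φ.source, ∀ g : G, x <• g ∈ φ.source := fun x hx g => by
    rwa [hφ.mem_source, h.proj_act, ← hφ.mem_source]
  refine ⟨hact, fun x hx g => Prod.ext ?_ (hφ.snd_act x hx g)⟩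
  rw [hφ.fst_eq _ (hact x hx g), hφ.fst_eq x hx, h.proj_act]

theorem isGauge {U : Set B} {φ : PartialDiffeomorph I_X (I_B.prod I_G) X (B × G) ∞}
    (hφ : IsTrivialization pr U φ) : IsGauge I_X I_G ∞ (pr ⁻¹' U) fun x => (φ x).2 := by
  rw [← hφ.source_eq]
  exact ⟨φ.open_source, contMDiff_snd.comp_contMDiffOn φ.contMDiffOn,
    (h.isEquivariantChart hφ).act_mem, hφ.snd_act⟩

theorem proj_eq_iff {x y : X} : pr x = pr y ↔ ∃ g : G, x <• g = y := by
  refine ⟨fun hxy => ?_, fun ⟨g, hg⟩ => hg ▸ (h.proj_act x g).symm⟩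
  obtain ⟨U, φ, hb, hφ⟩ := h.exists_isTrivialization (pr x)
  have hx := hφ.mem_source.2 hb
  have hy := hφ.mem_source.2 (hxy ▸ hb)
  refine ((h.isEquivariantChart hφ).fst_eq_iff hx hy).1 ?_
  rw [hφ.fst_eq x hx, hφ.fst_eq y hy, hxy]

theorem exists_localSection (b : B) :
    ∃ σ : B → X, ContMDiffAt I_B I_X ∞ σ b ∧ ∀ᶠ y in 𝓝 b, pr (σ y) = y := by
  obtain ⟨U, φ, hb, hφ⟩ := h.exists_isTrivialization b
  exact ⟨fun y => φ.symm (y, 1),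
    (contMDiffAt_symm_of_mem_target φ (hφ.mk_mem_target hb 1)).comp b
      (contMDiffAt_id.prodMk contMDiffAt_const),
    Filter.eventually_of_mem (hφ.isOpen.mem_nhds hb) fun y hy => hφ.proj_symm hy 1⟩

theorem eq_of_act_eq_self {x : X} {g : G} (hg : x <• g = x) : g = 1 := by
  obtain ⟨U, φ, hb, hφ⟩ := h.exists_isTrivialization (pr x)
  have hsnd := hφ.snd_act x (hφ.mem_source.2 hb) g
  rwa [hg, left_eq_mul] at hsnd

end IsPrincipalBundle

end PrincipalBundles

section Topology

theorem t2Space_of_injOn_fiber {X Y Z : Type*} [TopologicalSpace X] [TopologicalSpace Y]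
    [TopologicalSpace Z] [T2Space Y] [T2Space Z] {f : X → Y} (hf : Continuous f)
    (h : ∀ y, ∃ (U : Set X) (g : X → Z),
      IsOpen U ∧ f ⁻¹' {y} ⊆ U ∧ ContinuousOn g U ∧ InjOn g U) : T2Space X := by
  refine ⟨fun a b hab => ?_⟩
  by_cases hfab : f a = f b
  · obtain ⟨U, g, hU, hfU, hg, hinj⟩ := h (f b)
    have ha : a ∈ U := hfU hfab
    have hb : b ∈ U := hfU rfl
    obtain ⟨u, v, hu, hv, hau, hbv, huv⟩ := t2_separation fun he => hab (hinj ha hb he)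
    exact ⟨U ∩ g ⁻¹' u, U ∩ g ⁻¹' v, hg.isOpen_inter_preimage hU hu,
      hg.isOpen_inter_preimage hU hv, ⟨ha, hau⟩, ⟨hb, hbv⟩,
      (huv.preimage g).mono inter_subset_right inter_subset_right⟩
  · exact separated_by_continuous hf hfab

variable {X F : Type*} [TopologicalSpace X] [TopologicalSpace F] (E : X → Type*)
  [TopologicalSpace (TotalSpace F E)] [∀ x, TopologicalSpace (E x)] [FiberBundle F E]

theorem t2Space_totalSpace [T2Space X] [T2Space F] : T2Space (TotalSpace F E) :=
  t2Space_of_injOn_fiber (FiberBundle.continuous_proj F E) fun x =>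
    let e := trivializationAt F E x
    ⟨e.source, e, e.open_source,
      fun _ hp => e.mem_source.2 (hp ▸ mem_baseSet_trivializationAt F E x),
      e.continuousOn, e.injOn⟩

theorem secondCountableTopology_totalSpace [SecondCountableTopology X]
    [SecondCountableTopology F] : SecondCountableTopology (TotalSpace F E) := by
  obtain ⟨s, hs, hsU⟩ := TopologicalSpace.countable_cover_nhds
    fun x : X => (trivializationAt F E x).open_baseSet.mem_nhds
      (mem_baseSet_trivializationAt F E x)
  have : Countable s := hs.to_subtype
  have (x : s) : SecondCountableTopology (trivializationAt F E (x : X)).source :=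
    (trivializationAt F E
      (x : X)).toOpenPartialHomeomorph.toHomeomorphSourceTarget.secondCountableTopology
  refine TopologicalSpace.secondCountableTopology_of_countable_cover
    (fun x : s => (trivializationAt F E (x : X)).open_source) (eq_univ_of_forall fun p => ?_)
  obtain ⟨x, hx, hpx⟩ := mem_iUnion₂.1 (hsU ▸ mem_univ p.1)
  exact mem_iUnion.2 ⟨⟨x, hx⟩, (trivializationAt F E x).mem_source.2 hpx⟩

end Topology

section OrbitMaps

variable {E_X H_X X E_Y H_Y Y E_P H_P P E_M H_M M E_G H_G G : Type*}
  [NormedAddCommGroup E_X] [NormedSpace ℝ E_X] [TopologicalSpace H_X]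
  {I_X : ModelWithCorners ℝ E_X H_X} [TopologicalSpace X] [ChartedSpace H_X X]
  [NormedAddCommGroup E_Y] [NormedSpace ℝ E_Y] [TopologicalSpace H_Y]
  {I_Y : ModelWithCorners ℝ E_Y H_Y} [TopologicalSpace Y] [ChartedSpace H_Y Y]
  [NormedAddCommGroup E_P] [NormedSpace ℝ E_P] [TopologicalSpace H_P]
  {I_P : ModelWithCorners ℝ E_P H_P} [TopologicalSpace P] [ChartedSpace H_P P]
  [NormedAddCommGroup E_M] [NormedSpace ℝ E_M] [TopologicalSpace H_M]
  {I_M : ModelWithCorners ℝ E_M H_M} [TopologicalSpace M] [ChartedSpace H_M M]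
  [NormedAddCommGroup E_G] [NormedSpace ℝ E_G] [TopologicalSpace H_G]
  {I_G : ModelWithCorners ℝ E_G H_G} [TopologicalSpace G] [ChartedSpace H_G G]
  [Group G] [MulAction Gᵐᵒᵖ X] [MulAction Gᵐᵒᵖ P]

/-- `q : X → Y` is a smooth orbit map of the right action of `G` on `X`: the action and `q` are
smooth, the fibres of `q` are the orbits, and `q` has a smooth section near every point of `Y`.
Smoothness of the section is only required at the point. -/
structure IsSmoothOrbitMap (I_X : ModelWithCorners ℝ E_X H_X) (I_Y : ModelWithCorners ℝ E_Y H_Y)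
    (I_G : ModelWithCorners ℝ E_G H_G) (q : X → Y) : Prop where
  contMDiff_act : ContMDiff (I_X.prod I_G) I_X ∞ fun p : X × G => p.1 <• p.2
  contMDiff : ContMDiff I_X I_Y ∞ q
  apply_eq_iff : ∀ x x' : X, q x = q x' ↔ ∃ g : G, x <• g = x'
  exists_localSection : ∀ y : Y,
    ∃ σ : Y → X, ContMDiffAt I_Y I_X ∞ σ y ∧ ∀ᶠ z in 𝓝 y, q (σ z) = z

theorem IsPrincipalBundle.isSmoothOrbitMap {q : X → Y}
    (h : IsPrincipalBundle (G := G) I_X I_Y I_G q) :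
    IsSmoothOrbitMap (G := G) I_X I_Y I_G q :=
  ⟨h.contMDiff_act, h.contMDiff_proj, fun _ _ => h.proj_eq_iff, h.exists_localSection⟩

theorem IsPrincipalBundle.exists_isGauge_of_equivariant {pr : P → M}
    (h : IsPrincipalBundle (G := G) I_P I_M I_G pr) {t : X → P} (ht : ContMDiff I_X I_P ∞ t)
    (hact : ∀ (x : X) (g : G), t (x <• g) = t x <• g) {f : X → M} (hf : ∀ x, f x = pr (t x))
    (m : M) : ∃ (U : Set M) (γ : X → G), IsOpen U ∧ m ∈ U ∧ IsGauge I_X I_G ∞ (f ⁻¹' U) γ := by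
  obtain ⟨U, φ, hm, hφ⟩ := h.exists_isTrivialization m
  have hpre : f ⁻¹' U = t ⁻¹' (pr ⁻¹' U) := by
    ext x
    simp only [mem_preimage, hf]
  exact ⟨U, (fun u => (φ u).2) ∘ t, hφ.isOpen, hm, hpre ▸ (h.isGauge hφ).comp ht hact⟩

namespace IsSmoothOrbitMap

variable {q : X → Y} (hq : IsSmoothOrbitMap (G := G) I_X I_Y I_G q)
include hq

theorem apply_act (x : X) (g : G) : q (x <• g) = q x :=
  ((hq.apply_eq_iff x _).2 ⟨g, rfl⟩).symm

theorem surjective : Surjective q := fun y =>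
  let ⟨σ, _, hσ⟩ := hq.exists_localSection y
  ⟨σ y, hσ.self_of_nhds⟩

/-- The section of `q` whose values are the gauge-fixed representatives for `γ`. -/
def gaugeSection (hq : IsSmoothOrbitMap (G := G) I_X I_Y I_G q) (γ : X → G) (y : Y) : X :=
  gaugeFix γ (surjInv hq.surjective y)

theorem apply_gaugeSection (γ : X → G) (y : Y) : q (hq.gaugeSection γ y) = y := by
  rw [gaugeSection, gaugeFix, hq.apply_act, surjInv_eq hq.surjective]

theorem gaugeSection_apply {W : Set X} {γ : X → G} (hγ : IsGauge I_X I_G ∞ W γ) {x : X}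
    (hx : x ∈ W) : hq.gaugeSection γ (q x) = gaugeFix γ x := by
  obtain ⟨g, hg⟩ := (hq.apply_eq_iff x (surjInv hq.surjective (q x))).1 (surjInv_eq _ _).symm
  rw [gaugeSection, ← hg, hγ.gaugeFix_act hx]

theorem contMDiffAt_gaugeSection [LieGroup I_G ∞ G] {V : Set Y} {γ : X → G}
    (hγ : IsGauge I_X I_G ∞ (q ⁻¹' V) γ) {y : Y} (hy : y ∈ V) :
    ContMDiffAt I_Y I_X ∞ (hq.gaugeSection γ) y := by
  obtain ⟨σ, hσ, hqσ⟩ := hq.exists_localSection y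
  have hσy : σ y ∈ q ⁻¹' V := by rwa [mem_preimage, hqσ.self_of_nhds]
  have hσV : ∀ᶠ z in 𝓝 y, σ z ∈ q ⁻¹' V :=
    hσ.continuousAt.eventually_mem (hγ.isOpen.mem_nhds hσy)
  have hsmooth : ContMDiffAt I_Y I_X ∞ (fun z => gaugeFix γ (σ z)) y :=
    ((hγ.contMDiffOn_gaugeFix hq.contMDiff_act).contMDiffAt (hγ.isOpen.mem_nhds hσy)).comp y hσ
  refine hsmooth.congr_of_eventuallyEq ?_
  filter_upwards [hqσ, hσV] with z hz hzV
  rw [← hq.gaugeSection_apply hγ hzV, hz]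

/-- The trivialization of `q` over `V` defined by a gauge over `q ⁻¹' V`. -/
def trivialization [LieGroup I_G ∞ G] (hq : IsSmoothOrbitMap (G := G) I_X I_Y I_G q) {V : Set Y}
    (hV : IsOpen V) {γ : X → G} (hγ : IsGauge I_X I_G ∞ (q ⁻¹' V) γ) :
    PartialDiffeomorph I_X (I_Y.prod I_G) X (Y × G) ∞ where
  toFun x := (q x, γ x)
  invFun p := hq.gaugeSection γ p.1 <• p.2
  source := q ⁻¹' V
  target := V ×ˢ univ
  map_source' x hx := ⟨hx, mem_univ _⟩
  map_target' p hp := by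
    rw [mem_preimage, hq.apply_act, hq.apply_gaugeSection]
    exact hp.1
  left_inv' x hx := by
    rw [hq.gaugeSection_apply hγ hx, gaugeFix_act_self]
  right_inv' p hp := by
    have hsurj : surjInv hq.surjective p.1 ∈ q ⁻¹' V := by
      rw [mem_preimage, surjInv_eq hq.surjective]
      exact hp.1
    have hmem : hq.gaugeSection γ p.1 ∈ q ⁻¹' V := hγ.act_mem _ hsurj _
    have hone : γ (hq.gaugeSection γ p.1) = 1 := hγ.apply_gaugeFix hsurj
    rw [hq.apply_act, hq.apply_gaugeSection, hγ.map_act _ hmem, hone, one_mul]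
  open_source := hγ.isOpen
  open_target := hV.prod isOpen_univ
  contMDiffOn_toFun := hq.contMDiff.contMDiffOn.prodMk hγ.contMDiffOn
  contMDiffOn_invFun _ hp := ((hq.contMDiff_act _).comp _
    (((hq.contMDiffAt_gaugeSection hγ hp.1).comp _ contMDiffAt_fst).prodMk
      contMDiffAt_snd)).contMDiffWithinAt

theorem isPrincipalBundle_of_isGauge [LieGroup I_G ∞ G]
    (h : ∀ y, ∃ (V : Set Y) (γ : X → G), IsOpen V ∧ y ∈ V ∧ IsGauge I_X I_G ∞ (q ⁻¹' V) γ) :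
    IsPrincipalBundle (G := G) I_X I_Y I_G q where
  contMDiff_act := hq.contMDiff_act
  contMDiff_proj := hq.contMDiff
  proj_act := hq.apply_act
  exists_trivialization y := by
    obtain ⟨V, γ, hV, hy, hγ⟩ := h y
    exact ⟨V, hq.trivialization hV hγ, hV, hy, rfl, rfl, fun _ _ => rfl, hγ.map_act⟩

section Equivariant

variable {pr : P → M} (h : IsPrincipalBundle (G := G) I_P I_M I_G pr) {t : X → P} {p : Y → M}
  (ht : ContMDiff I_X I_P ∞ t) (hact : ∀ (x : X) (g : G), t (x <• g) = t x <• g)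
  (hpq : ∀ x, p (q x) = pr (t x))
include h ht hact hpq

theorem isPrincipalBundle_of_equivariant [LieGroup I_G ∞ G] (hp : Continuous p) :
    IsPrincipalBundle (G := G) I_X I_Y I_G q := by
  refine hq.isPrincipalBundle_of_isGauge fun y => ?_
  obtain ⟨U, γ, hU, hy, hγ⟩ := h.exists_isGauge_of_equivariant ht hact hpq (p y)
  exact ⟨p ⁻¹' U, γ, hU.preimage hp, hy, hγ⟩

theorem t2Space_of_equivariant [LieGroup I_G ∞ G] [T2Space M] [T2Space X] (hp : Continuous p) :
    T2Space Y := by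
  refine t2Space_of_injOn_fiber (Z := X) hp fun m => ?_
  obtain ⟨U, γ, hU, hm, hγ⟩ := h.exists_isGauge_of_equivariant ht hact hpq m
  refine ⟨p ⁻¹' U, hq.gaugeSection γ, hU.preimage hp, fun y hy => ?_, fun y hy => ?_, ?_⟩
  · rw [mem_preimage, show p y = m from hy]
    exact hm
  · exact (hq.contMDiffAt_gaugeSection (V := p ⁻¹' U) hγ hy).continuousAt.continuousWithinAt
  · exact (LeftInverse.injective (hq.apply_gaugeSection γ)).injOn

end Equivariant

end IsSmoothOrbitMap

namespace IsPrincipalBundle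

variable {q : X → Y} {q' : P → Y} (h : IsPrincipalBundle (G := G) I_X I_Y I_G q)
  (h' : IsPrincipalBundle (G := G) I_P I_Y I_G q') {f : X → P}
include h h'

theorem bijective_of_equivariant (hact : ∀ (x : X) (g : G), f (x <• g) = f x <• g)
    (hproj : ∀ x, q' (f x) = q x) : Bijective f := by
  refine ⟨fun x x' hxx' => ?_, fun u => ?_⟩
  · obtain ⟨g, rfl⟩ := h.proj_eq_iff.1
      (((hproj x).symm.trans (congrArg q' hxx')).trans (hproj x'))
    rw [hact] at hxx'
    rw [h'.eq_of_act_eq_self hxx'.symm, act_one]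
  · obtain ⟨x, hx⟩ := h.isSmoothOrbitMap.surjective (q' u)
    obtain ⟨g, hg⟩ := h'.proj_eq_iff.1 ((hproj x).trans hx)
    exact ⟨x <• g, (hact x g).trans hg⟩

theorem isPrincipalBundleIso_of_equivariant [LieGroup I_G ∞ G] (hf : ContMDiff I_X I_P ∞ f)
    (hact : ∀ (x : X) (g : G), f (x <• g) = f x <• g) (hproj : ∀ x, q' (f x) = q x) :
    IsPrincipalBundleIso G I_X I_P q q' f := by
  refine ⟨⟨⟨Equiv.ofBijective f (h.bijective_of_equivariant h' hact hproj), hf, fun u => ?_⟩, rfl⟩,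
    hproj, hact⟩
  obtain ⟨U, φ, hu, hφ⟩ := h'.exists_isTrivialization (q' u)
  have hγ' := h'.isGauge hφ
  have hpre : f ⁻¹' (q' ⁻¹' U) = q ⁻¹' U := by
    ext x
    simp only [mem_preimage, hproj]
  have hγ := hpre ▸ hγ'.comp hf hact
  have hq := h.isSmoothOrbitMap
  have hsmooth : ContMDiffAt I_P I_X ∞
      (fun v => hq.gaugeSection ((fun v => (φ v).2) ∘ f) (q' v) <• (φ v).2) u :=
    (hq.contMDiff_act _).comp u (((hq.contMDiffAt_gaugeSection hγ hu).comp u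
      (h'.contMDiff_proj u)).prodMk (hγ'.contMDiffAt hu))
  refine hsmooth.congr_of_eventuallyEq ?_
  filter_upwards [hγ'.isOpen.mem_nhds hu] with v hv
  obtain ⟨x, rfl⟩ := (h.bijective_of_equivariant h' hact hproj).surjective v
  have hx : x ∈ q ⁻¹' U := hpre ▸ hv
  rw [hproj, hq.gaugeSection_apply hγ hx]
  exact ((Equiv.ofBijective f _).symm_apply_apply x).trans
    (gaugeFix_act_self ((fun v => (φ v).2) ∘ f) x).symm

end IsPrincipalBundle

end OrbitMaps

theorem comp_comp_comp_eq_of_comp_eq_id {R E E' F F' : Type*} [Semiring R]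
    [AddCommMonoid E] [Module R E] [TopologicalSpace E]
    [AddCommMonoid E'] [Module R E'] [TopologicalSpace E']
    [AddCommMonoid F] [Module R F] [TopologicalSpace F]
    [AddCommMonoid F'] [Module R F'] [TopologicalSpace F']
    {a : E' →L[R] E} {b : E →L[R] E'} {c : F' →L[R] F} {d : F →L[R] F'}
    (hab : a ∘L b = .id R E) (hcd : c ∘L d = .id R F) (φ : F →L[R] E) :
    a ∘L (b ∘L φ ∘L c) ∘L d = φ := by
  ext v
  exact congr($hab (φ (c (d v)))).trans congr(φ ($hcd v))

section TangentCoordinates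

variable {E E' E'' E_Z H H' H'' H_Z M M' M'' Z : Type*}
  [NormedAddCommGroup E] [NormedSpace ℝ E] [TopologicalSpace H]
  [NormedAddCommGroup E'] [NormedSpace ℝ E'] [TopologicalSpace H']
  [NormedAddCommGroup E''] [NormedSpace ℝ E''] [TopologicalSpace H'']
  [NormedAddCommGroup E_Z] [NormedSpace ℝ E_Z] [TopologicalSpace H_Z]
  {I : ModelWithCorners ℝ E H} {I' : ModelWithCorners ℝ E' H'} {I'' : ModelWithCorners ℝ E'' H''}
  {I_Z : ModelWithCorners ℝ E_Z H_Z}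
  [TopologicalSpace M] [ChartedSpace H M] [IsManifold I 1 M]
  [TopologicalSpace M'] [ChartedSpace H' M'] [IsManifold I' 1 M']
  [TopologicalSpace Z] [ChartedSpace H_Z Z] {n : WithTop ℕ∞} {a : Z → M} {b : Z → M'}
  {φ : Z → E →L[ℝ] E'} {z₀ : Z}

section Comp

variable [TopologicalSpace M''] [ChartedSpace H'' M''] [IsManifold I'' 1 M''] {c : Z → M''}
  {ψ : Z → E' →L[ℝ] E''}

omit [TopologicalSpace Z] in
theorem inTangentCoordinates_comp {z : Z} (hz : b z ∈ (chartAt H' (b z₀)).source) :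
    inTangentCoordinates I I'' a c (fun z => ψ z ∘L φ z) z₀ z =
      inTangentCoordinates I' I'' b c ψ z₀ z ∘L inTangentCoordinates I I' a b φ z₀ z := by
  ext v
  simp only [inTangentCoordinates, ContinuousLinearMap.inCoordinates,
    ContinuousLinearMap.comp_apply]
  congr 1
  exact congrArg (ψ z) ((trivializationAt E' (TangentSpace I' : M' → Type _)
    (b z₀)).symmL_continuousLinearMapAt hz _).symm

theorem contMDiffAt_inTangentCoordinates_comp (hb : ContinuousAt b z₀)
    (hψ : ContMDiffAt I_Z 𝓘(ℝ, E' →L[ℝ] E'') n (inTangentCoordinates I' I'' b c ψ z₀) z₀)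
    (hφ : ContMDiffAt I_Z 𝓘(ℝ, E →L[ℝ] E') n (inTangentCoordinates I I' a b φ z₀) z₀) :
    ContMDiffAt I_Z 𝓘(ℝ, E →L[ℝ] E'') n
      (inTangentCoordinates I I'' a c (fun z => ψ z ∘L φ z) z₀) z₀ := by
  refine (hψ.clm_comp hφ).congr_of_eventuallyEq ?_
  filter_upwards [hb.eventually_mem (chart_source_mem_nhds H' (b z₀))] with z hz
  exact inTangentCoordinates_comp hz

end Comp

theorem contMDiffAt_inTangentCoordinates_mfderiv {f : M → M'} (hf : ContMDiffAt I I' ∞ f (a z₀))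
    (ha : ContMDiffAt I_Z I ∞ a z₀) :
    ContMDiffAt I_Z 𝓘(ℝ, E →L[ℝ] E') ∞
      (inTangentCoordinates I I' a (fun z => f (a z)) (fun z => mfderiv I I' f (a z)) z₀) z₀ :=
  (hf.mfderiv_const (m := ∞) le_rfl).comp z₀ ha

theorem contMDiffAt_inTangentCoordinates_congr_right {b' : Z → M'}
    (h : ContMDiffAt I_Z 𝓘(ℝ, E →L[ℝ] E') n (inTangentCoordinates I I' a b φ z₀) z₀)
    (hb : b =ᶠ[𝓝 z₀] b') :
    ContMDiffAt I_Z 𝓘(ℝ, E →L[ℝ] E') n (inTangentCoordinates I I' a b' φ z₀) z₀ := by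
  refine h.congr_of_eventuallyEq ?_
  filter_upwards [hb] with z hz
  rw [inTangentCoordinates, inTangentCoordinates, hb.self_of_nhds, hz]

end TangentCoordinates

namespace PrincipalBundle

section HomBundleCoordinates

variable {E_M E_G E_P M G P : Type*}
  [NormedAddCommGroup E_M] [NormedSpace ℝ E_M] [NormedAddCommGroup E_G] [NormedSpace ℝ E_G]
  [NormedAddCommGroup E_P] [NormedSpace ℝ E_P]
  [TopologicalSpace M] [ChartedSpace E_M M] [IsManifold 𝓘(ℝ, E_M) ∞ M]
  [TopologicalSpace G] [ChartedSpace E_G G] [Group G]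
  [TopologicalSpace P] [ChartedSpace E_P P] [IsManifold 𝓘(ℝ, E_P) ∞ P] [MulAction Gᵐᵒᵖ P]
  (B : PrincipalBundle E_M E_G E_P M G P)

omit [IsManifold 𝓘(ℝ, E_P) ∞ P] in
theorem symmL_pullback (u₀ u : P) (v : E_M) :
    (trivializationAt E_M (B.proj *ᵖ (TangentSpace 𝓘(ℝ, E_M) : M → Type _)) u₀).symmL ℝ u v =
      (trivializationAt E_M (TangentSpace 𝓘(ℝ, E_M) : M → Type _) (B.proj u₀)).symmL ℝ
        (B.proj u) v := by
  let e := trivializationAt E_M (TangentSpace 𝓘(ℝ, E_M) : M → Type _) (B.proj u₀)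
  let e' := trivializationAt E_M (B.proj *ᵖ (TangentSpace 𝓘(ℝ, E_M) : M → Type _)) u₀
  by_cases hu : B.proj u ∈ e.baseSet
  · have hu' : u ∈ e'.baseSet := hu
    rw [e'.symmL_apply hu', e.symmL_apply hu, e'.symm_apply hu']
    rfl
  · have hu' : u ∉ e'.baseSet := hu
    rw [e'.symmL_apply_of_notMem hu', e.symmL_apply_of_notMem hu]
    rfl

variable {E_Z H_Z Z : Type*} [NormedAddCommGroup E_Z] [NormedSpace ℝ E_Z] [TopologicalSpace H_Z]
  {I_Z : ModelWithCorners ℝ E_Z H_Z} [TopologicalSpace Z] [ChartedSpace H_Z Z]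

theorem contMDiffAt_homBundle_iff (f : Z → B.HomBundle) (z₀ : Z) :
    ContMDiffAt I_Z (𝓘(ℝ, E_P).prod 𝓘(ℝ, E_M →L[ℝ] E_P)) ∞ f z₀ ↔
      ContMDiffAt I_Z 𝓘(ℝ, E_P) ∞ (fun z => (f z).1) z₀ ∧
      ContMDiffAt I_Z 𝓘(ℝ, E_M →L[ℝ] E_P) ∞
        (inTangentCoordinates 𝓘(ℝ, E_M) 𝓘(ℝ, E_P) (fun z => B.proj (f z).1) (fun z => (f z).1)
          (fun z => (f z).2) z₀) z₀ := by
  have hcoord : (fun z => ContinuousLinearMap.inCoordinates E_M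
      (B.proj *ᵖ (TangentSpace 𝓘(ℝ, E_M) : M → Type _)) E_P (TangentSpace 𝓘(ℝ, E_P) : P → Type _)
      (f z₀).1 (f z).1 (f z₀).1 (f z).1 (f z).2) =
      inTangentCoordinates 𝓘(ℝ, E_M) 𝓘(ℝ, E_P) (fun z => B.proj (f z).1) (fun z => (f z).1)
        (fun z => (f z).2) z₀ := by
    ext z v
    simp only [inTangentCoordinates, ContinuousLinearMap.inCoordinates,
      ContinuousLinearMap.comp_apply]
    congr 1
    exact congrArg (f z).2 (B.symmL_pullback _ _ v)
  rw [contMDiffAt_hom_bundle, hcoord]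

variable {V W : Type*} [NormedAddCommGroup V] [NormedSpace ℝ V]
  [NormedAddCommGroup W] [NormedSpace ℝ W]
  (Q : PartialDiffeomorph 𝓘(ℝ, E_P) 𝓘(ℝ, V) P V ∞)
  (c : PartialDiffeomorph 𝓘(ℝ, E_M) 𝓘(ℝ, W) M W ∞)

/-- The coordinates `(Q u, dQ ∘ φ ∘ dc⁻¹)` of a linear map `φ : T_{τ(u)}M → T_uP`, for a chart `Q`
of `P` and a chart `c` of `M`. -/
def homCoord (η : B.HomBundle) : V × (W →L[ℝ] V) :=
  (Q η.1, (mfderiv 𝓘(ℝ, E_P) 𝓘(ℝ, V) Q η.1 : E_P →L[ℝ] V) ∘L (η.2 : E_M →L[ℝ] E_P) ∘L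
    (mfderiv 𝓘(ℝ, W) 𝓘(ℝ, E_M) c.symm (c (B.proj η.1)) : W →L[ℝ] E_M))

/-- The element of `Hom(τ^*TM, TP)` with the given coordinates: the inverse of `homCoord`. -/
def homCoordSymm (y : V × (W →L[ℝ] V)) : B.HomBundle :=
  ⟨Q.symm y.1, ((mfderiv 𝓘(ℝ, V) 𝓘(ℝ, E_P) Q.symm y.1 : V →L[ℝ] E_P) ∘L y.2 ∘L
    (mfderiv 𝓘(ℝ, E_M) 𝓘(ℝ, W) c (B.proj (Q.symm y.1)) : E_M →L[ℝ] W) : E_M →L[ℝ] E_P)⟩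

variable {Q c}

omit [IsManifold 𝓘(ℝ, E_M) ∞ M] [IsManifold 𝓘(ℝ, E_P) ∞ P] in
theorem homCoordSymm_homCoord {η : B.HomBundle} (hQ : η.1 ∈ Q.source)
    (hc : B.proj η.1 ∈ c.source) : B.homCoordSymm Q c (B.homCoord Q c η) = η := by
  obtain ⟨u, φ⟩ := η
  have hu : Q.symm (Q u) = u := Q.left_inv hQ
  refine TotalSpace.ext hu (heq_of_eq ?_)
  change (mfderiv 𝓘(ℝ, V) 𝓘(ℝ, E_P) Q.symm (Q u) : V →L[ℝ] E_P) ∘L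
    ((mfderiv 𝓘(ℝ, E_P) 𝓘(ℝ, V) Q u : E_P →L[ℝ] V) ∘L (φ : E_M →L[ℝ] E_P) ∘L
      (mfderiv 𝓘(ℝ, W) 𝓘(ℝ, E_M) c.symm (c (B.proj u)) : W →L[ℝ] E_M)) ∘L
      (mfderiv 𝓘(ℝ, E_M) 𝓘(ℝ, W) c (B.proj (Q.symm (Q u))) : E_M →L[ℝ] W) = φ
  rw [hu]
  exact comp_comp_comp_eq_of_comp_eq_id (mfderiv_symm_comp_mfderiv_of_mem_source Q (by simp) hQ)
    (mfderiv_symm_comp_mfderiv_of_mem_source c (by simp) hc) φ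

omit [IsManifold 𝓘(ℝ, E_M) ∞ M] [IsManifold 𝓘(ℝ, E_P) ∞ P] in
theorem homCoord_homCoordSymm {y : V × (W →L[ℝ] V)} (hQ : y.1 ∈ Q.target)
    (hc : B.proj (Q.symm y.1) ∈ c.source) : B.homCoord Q c (B.homCoordSymm Q c y) = y := by
  obtain ⟨v, A⟩ := y
  refine Prod.ext (Q.right_inv hQ) ?_
  change (mfderiv 𝓘(ℝ, E_P) 𝓘(ℝ, V) Q (Q.symm v) : E_P →L[ℝ] V) ∘L
    ((mfderiv 𝓘(ℝ, V) 𝓘(ℝ, E_P) Q.symm v : V →L[ℝ] E_P) ∘L A ∘L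
      (mfderiv 𝓘(ℝ, E_M) 𝓘(ℝ, W) c (B.proj (Q.symm v)) : E_M →L[ℝ] W)) ∘L
      (mfderiv 𝓘(ℝ, W) 𝓘(ℝ, E_M) c.symm (c (B.proj (Q.symm v))) : W →L[ℝ] E_M) = A
  exact comp_comp_comp_eq_of_comp_eq_id (mfderiv_comp_mfderiv_symm_of_mem_target Q (by simp) hQ)
    (mfderiv_comp_mfderiv_symm_of_mem_source c (by simp) hc) A

theorem contMDiffAt_homCoord {η : B.HomBundle} (hQ : η.1 ∈ Q.source) (hc : B.proj η.1 ∈ c.source) :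
    ContMDiffAt (𝓘(ℝ, E_P).prod 𝓘(ℝ, E_M →L[ℝ] E_P)) 𝓘(ℝ, V × (W →L[ℝ] V)) ∞
      (B.homCoord Q c) η := by
  obtain ⟨hbase, hφ⟩ := (B.contMDiffAt_homBundle_iff id η).1 contMDiffAt_id
  simp only [id] at hbase hφ
  have hτ := B.proj.contMDiff.contMDiffAt.comp η hbase
  have hdQ := contMDiffAt_inTangentCoordinates_mfderiv (contMDiffAt_of_mem_source Q hQ) hbase
  have hdc := contMDiffAt_inTangentCoordinates_mfderiv (a := fun η => c (B.proj η.1))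
    (contMDiffAt_symm_of_mem_target c (c.map_source hc))
    ((contMDiffAt_of_mem_source c hc).comp η hτ)
  have hleft : (fun η : B.HomBundle => c.symm (c (B.proj η.1))) =ᶠ[𝓝 η] fun η => B.proj η.1 := by
    filter_upwards [hτ.continuousAt.eventually_mem (c.open_source.mem_nhds hc)] with η' hη'
    exact c.left_inv hη'
  have h := contMDiffAt_inTangentCoordinates_comp hbase.continuousAt hdQ
    (contMDiffAt_inTangentCoordinates_comp hτ.continuousAt hφ
      (contMDiffAt_inTangentCoordinates_congr_right hdc hleft))
  rw [inTangentCoordinates_model_space] at h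
  exact ((contMDiffAt_of_mem_source Q hQ).comp η hbase).prodMk_space h

theorem contMDiffAt_homCoordSymm {y : V × (W →L[ℝ] V)} (hQ : y.1 ∈ Q.target)
    (hc : B.proj (Q.symm y.1) ∈ c.source) :
    ContMDiffAt 𝓘(ℝ, V × (W →L[ℝ] V)) (𝓘(ℝ, E_P).prod 𝓘(ℝ, E_M →L[ℝ] E_P)) ∞
      (B.homCoordSymm Q c) y := by
  have hfst : ContMDiffAt 𝓘(ℝ, V × (W →L[ℝ] V)) 𝓘(ℝ, V) ∞ Prod.fst y :=
    contDiffAt_fst.contMDiffAt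
  have hsnd : ContMDiffAt 𝓘(ℝ, V × (W →L[ℝ] V)) 𝓘(ℝ, W →L[ℝ] V) ∞ Prod.snd y :=
    contDiffAt_snd.contMDiffAt
  have hbase := (contMDiffAt_symm_of_mem_target Q hQ).comp y hfst
  have hτ := B.proj.contMDiff.contMDiffAt.comp y hbase
  have hcτ := (contMDiffAt_of_mem_source c hc).comp y hτ
  have hdQ := contMDiffAt_inTangentCoordinates_mfderiv (contMDiffAt_symm_of_mem_target Q hQ) hfst
  have hdc := contMDiffAt_inTangentCoordinates_mfderiv (a := fun z => B.proj (Q.symm z.1)) (z₀ := y)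
    (contMDiffAt_of_mem_source c hc) hτ
  have hA : ContMDiffAt 𝓘(ℝ, V × (W →L[ℝ] V)) 𝓘(ℝ, W →L[ℝ] V) ∞
      (inTangentCoordinates 𝓘(ℝ, W) 𝓘(ℝ, V) (c ∘ B.proj ∘ Q.symm ∘ Prod.fst) Prod.fst
        (fun y => y.2) y) y := by
    rwa [inTangentCoordinates_model_space]
  exact (B.contMDiffAt_homBundle_iff _ y).2 ⟨hbase,
    contMDiffAt_inTangentCoordinates_comp hfst.continuousAt hdQ
      (contMDiffAt_inTangentCoordinates_comp hcτ.continuousAt hA hdc)⟩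

/-- The chart of `Hom(τ^*TM, TP)` with coordinates `homCoord`. -/
def homChart (hQc : ∀ u ∈ Q.source, B.proj u ∈ c.source) :
    PartialDiffeomorph (𝓘(ℝ, E_P).prod 𝓘(ℝ, E_M →L[ℝ] E_P)) 𝓘(ℝ, V × (W →L[ℝ] V))
      B.HomBundle (V × (W →L[ℝ] V)) ∞ where
  toFun := B.homCoord Q c
  invFun := B.homCoordSymm Q c
  source := {η | η.1 ∈ Q.source}
  target := {y | y.1 ∈ Q.target}
  map_source' _ hη := Q.map_source hη
  map_target' _ hy := Q.map_target hy
  left_inv' _ hη := B.homCoordSymm_homCoord hη (hQc _ hη)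
  right_inv' _ hy := B.homCoord_homCoordSymm hy (hQc _ (Q.map_target hy))
  open_source := Q.open_source.preimage (FiberBundle.continuous_proj _ _)
  open_target := Q.open_target.preimage continuous_fst
  contMDiffOn_toFun _ hη := (B.contMDiffAt_homCoord hη (hQc _ hη)).contMDiffWithinAt
  contMDiffOn_invFun _ hy :=
    (B.contMDiffAt_homCoordSymm hy (hQc _ (Q.map_target hy))).contMDiffWithinAt

end HomBundleCoordinates

end PrincipalBundle

section SliceCharts

variable {E H X E_S H_S S A K : Type*} [NormedAddCommGroup E] [NormedSpace ℝ E]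
  [TopologicalSpace H] {I : ModelWithCorners ℝ E H} [TopologicalSpace X] [ChartedSpace H X]
  [NormedAddCommGroup E_S] [NormedSpace ℝ E_S] [TopologicalSpace H_S]
  {I_S : ModelWithCorners ℝ E_S H_S} [TopologicalSpace S] [ChartedSpace H_S S]
  [NormedAddCommGroup A] [NormedSpace ℝ A] [NormedAddCommGroup K] [NormedSpace ℝ K]
  {n : WithTop ℕ∞} {Ψ : PartialDiffeomorph I 𝓘(ℝ, A × K) X (A × K) n} {i : S → X}

/-- The chart of an embedded submanifold induced by a slice chart of the ambient manifold, as a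
partial diffeomorphism. -/
def IsSliceChart.partialDiffeomorph [Nonempty S] (hΨ : IsSliceChart Ψ i)
    (hi : IsSmoothEmbedding I_S I n i) : PartialDiffeomorph I_S 𝓘(ℝ, A) S A n where
  toPartialEquiv := (hΨ.chart hi.isEmbedding).toPartialEquiv
  open_source := (hΨ.chart hi.isEmbedding).open_source
  open_target := (hΨ.chart hi.isEmbedding).open_target
  contMDiffOn_toFun := contDiff_fst.contMDiff.comp_contMDiffOn
    (Ψ.contMDiffOn.comp hi.isImmersion.contMDiff.contMDiffOn fun _ hs => hs)
  contMDiffOn_invFun a ha := by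
    have hsmooth : ContMDiffAt 𝓘(ℝ, A) I n (fun b => Ψ.symm (b, 0)) a :=
      (contMDiffAt_symm_of_mem_target Ψ ha).comp a (contDiff_prodMk_left 0).contMDiff.contMDiffAt
    have hmem : ∀ᶠ b in 𝓝 a, (b, 0) ∈ Ψ.target :=
      (hΨ.chart hi.isEmbedding).open_target.mem_nhds ha
    exact ((contMDiffAt_iff_comp_isSmoothEmbedding hi).2 (hsmooth.congr_of_eventuallyEq
      (hmem.mono fun b hb => hΨ.apply_invFun hb))).contMDiffWithinAt

end SliceCharts

namespace PrincipalBundle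

section JetCharts

variable {E_M E_G E_P M G P : Type*}
  [NormedAddCommGroup E_M] [NormedSpace ℝ E_M] [NormedAddCommGroup E_G] [NormedSpace ℝ E_G]
  [NormedAddCommGroup E_P] [NormedSpace ℝ E_P]
  [TopologicalSpace M] [ChartedSpace E_M M]
  [TopologicalSpace G] [ChartedSpace E_G G] [Group G]
  [TopologicalSpace P] [ChartedSpace E_P P] [MulAction Gᵐᵒᵖ P]
  {B : PrincipalBundle E_M E_G E_P M G P}
  {V W : Type*} [NormedAddCommGroup V] [NormedSpace ℝ V] [NormedAddCommGroup W] [NormedSpace ℝ W]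
  {Q : PartialDiffeomorph 𝓘(ℝ, E_P) 𝓘(ℝ, W × V) P (W × V) ∞}
  {c : PartialDiffeomorph 𝓘(ℝ, E_M) 𝓘(ℝ, W) M W ∞}

/-- The charts `Q` of `P` and `c` of `M` are adapted to each other: the bundle projection is the
first projection in them. -/
structure IsAdapted (B : PrincipalBundle E_M E_G E_P M G P)
    (Q : PartialDiffeomorph 𝓘(ℝ, E_P) 𝓘(ℝ, W × V) P (W × V) ∞)
    (c : PartialDiffeomorph 𝓘(ℝ, E_M) 𝓘(ℝ, W) M W ∞) : Prop where
  proj_mem : ∀ u ∈ Q.source, B.proj u ∈ c.source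
  fst_eq : ∀ u ∈ Q.source, (Q u).1 = c (B.proj u)

theorem isAdapted_of_isTrivialization {U : Set M}
    {φ : PartialDiffeomorph 𝓘(ℝ, E_P) (𝓘(ℝ, E_M).prod 𝓘(ℝ, E_G)) P (M × G) ∞}
    (hφ : IsTrivialization B.proj U φ) (c : PartialDiffeomorph 𝓘(ℝ, E_M) 𝓘(ℝ, W) M W ∞)
    (k : PartialDiffeomorph 𝓘(ℝ, E_G) 𝓘(ℝ, V) G V ∞) :
    B.IsAdapted (φ.trans (prodSpace c k)) c where
  proj_mem u hu := hφ.fst_eq u hu.1 ▸ hu.2.1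
  fst_eq u hu := congrArg c (hφ.fst_eq u hu.1)

theorem exists_isAdapted (B : PrincipalBundle E_M E_G E_P M G P)
    [IsManifold 𝓘(ℝ, E_M) ∞ M] [IsManifold 𝓘(ℝ, E_G) ∞ G] (u : P) :
    ∃ (Q : PartialDiffeomorph 𝓘(ℝ, E_P) 𝓘(ℝ, E_M × E_G) P (E_M × E_G) ∞)
      (c : PartialDiffeomorph 𝓘(ℝ, E_M) 𝓘(ℝ, E_M) M E_M ∞), u ∈ Q.source ∧ B.IsAdapted Q c := by
  obtain ⟨U, φ, hu, hφ⟩ := B.isPrincipalBundle.exists_isTrivialization (B.proj u)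
  exact ⟨φ.trans (prodSpace (chartDiffeomorph (φ u).1) (chartDiffeomorph (φ u).2)),
    chartDiffeomorph (φ u).1,
    ⟨hφ.mem_source.2 hu, mem_extChartAt_source (φ u).1, mem_extChartAt_source (φ u).2⟩,
    isAdapted_of_isTrivialization hφ _ _⟩

theorem IsAdapted.fst_comp_mfderiv (h : B.IsAdapted Q c) {u : P} (hu : u ∈ Q.source) :
    ContinuousLinearMap.fst ℝ W V ∘L (mfderiv 𝓘(ℝ, E_P) 𝓘(ℝ, W × V) Q u : E_P →L[ℝ] W × V) =
      (mfderiv 𝓘(ℝ, E_M) 𝓘(ℝ, W) c (B.proj u) : E_M →L[ℝ] W) ∘L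
        (B.tangentProj u : E_P →L[ℝ] E_M) := by
  have hfst := mfderiv_comp u (ContinuousLinearMap.fst ℝ W V).mdifferentiableAt
    ((contMDiffAt_of_mem_source Q hu).mdifferentiableAt (by simp))
  rw [ContinuousLinearMap.mfderiv_eq] at hfst
  have hproj := mfderiv_comp u
    ((contMDiffAt_of_mem_source c (h.proj_mem u hu)).mdifferentiableAt (by simp))
    (B.proj.contMDiff.mdifferentiable (by simp) u)
  have hQ : ContinuousLinearMap.fst ℝ W V ∘ Q =ᶠ[𝓝 u] c ∘ B.proj :=
    Filter.eventually_of_mem (Q.open_source.mem_nhds hu) h.fst_eq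
  exact hfst.symm.trans (hQ.mfderiv_eq.trans hproj)

theorem IsAdapted.fst_comp_homCoord_eq_id_iff (h : B.IsAdapted Q c) {η : B.HomBundle}
    (hη : η.1 ∈ Q.source) :
    ContinuousLinearMap.fst ℝ W V ∘L (B.homCoord Q c η).2 = .id ℝ W ↔
      ∀ v : TangentSpace 𝓘(ℝ, E_M) (B.proj η.1), B.tangentProj η.1 (η.2 v) = v := by
  let dQ : E_P →L[ℝ] W × V := mfderiv 𝓘(ℝ, E_P) 𝓘(ℝ, W × V) Q η.1
  let dc : E_M →L[ℝ] W := mfderiv 𝓘(ℝ, E_M) 𝓘(ℝ, W) c (B.proj η.1)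
  let dc' : W →L[ℝ] E_M := mfderiv 𝓘(ℝ, W) 𝓘(ℝ, E_M) c.symm (c (B.proj η.1))
  let dτ : E_P →L[ℝ] E_M := B.tangentProj η.1
  let φ : E_M →L[ℝ] E_P := η.2
  have hQ (w : E_P) : (dQ w).1 = dc (dτ w) := congr($(h.fst_comp_mfderiv hη) w)
  have hleft (v : E_M) : dc' (dc v) = v :=
    congr($(mfderiv_symm_comp_mfderiv_of_mem_source c (by simp) (h.proj_mem _ hη)) v)
  have hright (w : W) : dc (dc' w) = w :=
    congr($(mfderiv_comp_mfderiv_symm_of_mem_source c (by simp) (h.proj_mem _ hη)) w)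
  have hiff : ContinuousLinearMap.fst ℝ W V ∘L (dQ ∘L φ ∘L dc') = .id ℝ W ↔
      ∀ w, dc (dτ (φ (dc' w))) = w := by
    simp only [ContinuousLinearMap.ext_iff, ContinuousLinearMap.comp_apply,
      ContinuousLinearMap.coe_fst', hQ, ContinuousLinearMap.id_apply]
  have hcoord : (∀ w, dc (dτ (φ (dc' w))) = w) ↔ ∀ v : E_M, dτ (φ v) = v := by
    refine ⟨fun hφ v => ?_, fun hφ w => by rw [hφ, hright]⟩
    have hv := hφ (dc v)
    rw [hleft] at hv
    rw [← hleft (dτ (φ v)), hv, hleft]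
  exact hiff.trans hcoord

/-- Separates the coordinates `(x, g, A)` of a jet from the coordinate transverse to `J¹P`, which is
the deviation of the first component from the identity. -/
def jetSplitting (W V : Type*) [NormedAddCommGroup W] [NormedSpace ℝ W]
    [NormedAddCommGroup V] [NormedSpace ℝ V] :
    PartialDiffeomorph 𝓘(ℝ, (W × V) × (W →L[ℝ] W × V)) 𝓘(ℝ, ModelJ1 W V × (W →L[ℝ] W))
      ((W × V) × (W →L[ℝ] W × V)) (ModelJ1 W V × (W →L[ℝ] W)) ∞ where
  toFun y := ((y.1.1, y.1.2, ContinuousLinearMap.snd ℝ W V ∘L y.2),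
    ContinuousLinearMap.fst ℝ W V ∘L y.2 - .id ℝ W)
  invFun a := ((a.1.1, a.1.2.1),
    ContinuousLinearMap.inl ℝ W V ∘L (a.2 + .id ℝ W) + ContinuousLinearMap.inr ℝ W V ∘L a.1.2.2)
  source := univ
  target := univ
  map_source' _ _ := mem_univ _
  map_target' _ _ := mem_univ _
  left_inv' y _ := by
    refine Prod.ext rfl ?_
    ext v <;> simp
  right_inv' a _ := by
    refine Prod.ext (Prod.ext rfl (Prod.ext rfl ?_)) ?_ <;> ext v <;> simp
  open_source := isOpen_univ
  open_target := isOpen_univ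
  contMDiffOn_toFun := (ContDiff.contMDiff (by fun_prop)).contMDiffOn
  contMDiffOn_invFun := (ContDiff.contMDiff (by fun_prop)).contMDiffOn

variable [IsManifold 𝓘(ℝ, E_M) ∞ M] [IsManifold 𝓘(ℝ, E_P) ∞ P]

theorem IsAdapted.isSliceChart_incl (h : B.IsAdapted Q c) :
    IsSliceChart ((B.homChart h.proj_mem).trans (jetSplitting W V)) B.incl := by
  intro η hη
  have hrange : η ∈ range B.incl ↔
      ∀ v : TangentSpace 𝓘(ℝ, E_M) (B.proj η.1), B.tangentProj η.1 (η.2 v) = v :=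
    ⟨fun ⟨ρ, hρ⟩ => hρ ▸ ρ.2, fun hη => ⟨⟨η, hη⟩, rfl⟩⟩
  rw [hrange, ← h.fst_comp_homCoord_eq_id_iff hη.1]
  exact sub_eq_zero.symm

variable (B)

theorem isEmbedding_incl : IsEmbedding B.incl :=
  IsEmbedding.subtypeVal

theorem exists_isSmoothEmbedding_incl [IsManifold 𝓘(ℝ, E_G) ∞ G] :
    ∃ _ : ChartedSpace (ModelJ1 E_M E_G) B.J1, IsManifold 𝓘(ℝ, ModelJ1 E_M E_G) ∞ B.J1 ∧
      IsSmoothEmbedding 𝓘(ℝ, ModelJ1 E_M E_G) (𝓘(ℝ, E_P).prod 𝓘(ℝ, E_M →L[ℝ] E_P)) ∞ B.incl := by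
  refine exists_isSmoothEmbedding_of_isSliceChart (K := E_M →L[ℝ] E_M) (by simp)
    B.isEmbedding_incl fun ρ => ?_
  obtain ⟨Q, c, hQ, h⟩ := B.exists_isAdapted (B.tau10 ρ)
  exact ⟨(B.homChart h.proj_mem).trans (jetSplitting E_M E_G), ⟨hQ, mem_univ _⟩,
    h.isSliceChart_incl⟩

theorem t2Space_J1 [T2Space P] : T2Space B.J1 :=
  haveI : T2Space B.HomBundle := t2Space_totalSpace _
  B.isEmbedding_incl.t2Space

theorem secondCountableTopology_J1 [SecondCountableTopology P]
    [SecondCountableTopology (E_M →L[ℝ] E_P)] : SecondCountableTopology B.J1 :=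
  haveI : SecondCountableTopology B.HomBundle := secondCountableTopology_totalSpace _
  B.isEmbedding_incl.secondCountableTopology

end JetCharts

section JetAction

variable {E_M E_G E_P M G P : Type*}
  [NormedAddCommGroup E_M] [NormedSpace ℝ E_M] [NormedAddCommGroup E_G] [NormedSpace ℝ E_G]
  [NormedAddCommGroup E_P] [NormedSpace ℝ E_P]
  [TopologicalSpace M] [ChartedSpace E_M M] [IsManifold 𝓘(ℝ, E_M) ∞ M]
  [TopologicalSpace G] [ChartedSpace E_G G] [Group G]
  [TopologicalSpace P] [ChartedSpace E_P P] [IsManifold 𝓘(ℝ, E_P) ∞ P] [MulAction Gᵐᵒᵖ P]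
  {B : PrincipalBundle E_M E_G E_P M G P}
  {E_Z H_Z Z : Type*} [NormedAddCommGroup E_Z] [NormedSpace ℝ E_Z] [TopologicalSpace H_Z]
  {I_Z : ModelWithCorners ℝ E_Z H_Z} [TopologicalSpace Z] [ChartedSpace H_Z Z]

theorem contMDiffAt_incl_act [IsManifold I_Z 1 Z] {ρ : Z → B.J1} {g : Z → G} {z₀ : Z}
    (hρ : ContMDiffAt I_Z (𝓘(ℝ, E_P).prod 𝓘(ℝ, E_M →L[ℝ] E_P)) ∞ (fun z => B.incl (ρ z)) z₀)
    (hg : ContMDiffAt I_Z 𝓘(ℝ, E_G) ∞ g z₀) :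
    ContMDiffAt I_Z (𝓘(ℝ, E_P).prod 𝓘(ℝ, E_M →L[ℝ] E_P)) ∞
      (fun z => B.incl (ρ z <• g z)) z₀ := by
  obtain ⟨hbase, hφ⟩ := (B.contMDiffAt_homBundle_iff _ z₀).1 hρ
  have hact := B.isPrincipalBundle.contMDiff_act
  refine (B.contMDiffAt_homBundle_iff _ z₀).2
    ⟨hact.contMDiffAt.comp z₀ (hbase.prodMk hg), ?_⟩
  have htranslate : ContMDiffAt (I_Z.prod 𝓘(ℝ, E_P)) 𝓘(ℝ, E_P) ∞
      (uncurry fun (z : Z) (p : P) => p <• g z) (z₀, B.tau10 (ρ z₀)) :=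
    hact.contMDiffAt.comp (z₀, B.tau10 (ρ z₀))
      (contMDiffAt_snd.prodMk (ContMDiffAt.comp (z₀, B.tau10 (ρ z₀)) hg contMDiffAt_fst))
  have hderiv := ContMDiffAt.mfderiv (m := ∞) (fun (z : Z) (p : P) => p <• g z)
    (fun z => B.tau10 (ρ z)) htranslate hbase (by rfl)
  have hproj : (fun z => B.proj (B.incl (ρ z <• g z)).1) = fun z => B.proj (B.incl (ρ z)).1 :=
    funext fun z => B.tau1_act (ρ z) (g z)
  have hcomp := contMDiffAt_inTangentCoordinates_comp hbase.continuousAt hderiv hφ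
  rw [hproj]
  exact hcomp

variable [ChartedSpace (ModelJ1 E_M E_G) B.J1]
  (hi : IsSmoothEmbedding 𝓘(ℝ, ModelJ1 E_M E_G) (𝓘(ℝ, E_P).prod 𝓘(ℝ, E_M →L[ℝ] E_P)) ∞ B.incl)
include hi

theorem contMDiff_tau10 : ContMDiff 𝓘(ℝ, ModelJ1 E_M E_G) 𝓘(ℝ, E_P) ∞ B.tau10 := fun ρ =>
  ((B.contMDiffAt_homBundle_iff _ ρ).1 (hi.isImmersion.contMDiff ρ)).1

theorem contMDiff_act_J1 [IsManifold 𝓘(ℝ, E_G) ∞ G]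
    [IsManifold 𝓘(ℝ, ModelJ1 E_M E_G) ∞ B.J1] :
    ContMDiff (𝓘(ℝ, ModelJ1 E_M E_G).prod 𝓘(ℝ, E_G)) 𝓘(ℝ, ModelJ1 E_M E_G) ∞
      fun q : B.J1 × G => q.1 <• q.2 :=
  have : IsManifold 𝓘(ℝ, E_G) 1 G := .of_le (n := ∞) (by simp)
  have : IsManifold 𝓘(ℝ, ModelJ1 E_M E_G) 1 B.J1 := .of_le (n := ∞) (by simp)
  (contMDiff_iff_comp_isSmoothEmbedding hi).2 fun q =>
    contMDiffAt_incl_act (hi.isImmersion.contMDiff.contMDiffAt.comp q contMDiffAt_fst)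
      contMDiffAt_snd

end JetAction

/-- Regroups the coordinates `(x, g, A)` of a jet into the coordinates `(x, A)` of its orbit and the
coordinate `g` along the orbit. -/
def orbitSplitting (W V : Type*) [NormedAddCommGroup W] [NormedSpace ℝ W]
    [NormedAddCommGroup V] [NormedSpace ℝ V] : ModelJ1 W V ≃L[ℝ] ModelC W V × V :=
  ((ContinuousLinearEquiv.refl ℝ W).prodCongr (.prodComm ℝ V (W →L[ℝ] V))).trans
    (ContinuousLinearEquiv.prodAssoc ℝ W (W →L[ℝ] V) V).symm

section OrbitSpace

variable {E_M E_G E_P M G P : Type*}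
  [NormedAddCommGroup E_M] [NormedSpace ℝ E_M] [NormedAddCommGroup E_G] [NormedSpace ℝ E_G]
  [NormedAddCommGroup E_P] [NormedSpace ℝ E_P]
  [TopologicalSpace M] [ChartedSpace E_M M] [IsManifold 𝓘(ℝ, E_M) ∞ M]
  [TopologicalSpace G] [ChartedSpace E_G G] [Group G] [LieGroup 𝓘(ℝ, E_G) ∞ G]
  [TopologicalSpace P] [ChartedSpace E_P P] [IsManifold 𝓘(ℝ, E_P) ∞ P] [MulAction Gᵐᵒᵖ P]
  {B : PrincipalBundle E_M E_G E_P M G P}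

omit [LieGroup 𝓘(ℝ, E_G) ∞ G] in
theorem toC_eq_iff (ρ ρ' : B.J1) : B.toC ρ = B.toC ρ' ↔ ∃ g : G, ρ <• g = ρ' := by
  refine Quotient.eq.trans ⟨?_, ?_⟩
  · rintro ⟨a, rfl⟩
    exact ⟨a.unop⁻¹, inv_smul_smul a ρ'⟩
  · rintro ⟨g, rfl⟩
    exact ⟨MulOpposite.op g⁻¹, inv_smul_smul (MulOpposite.op g) ρ⟩

omit [LieGroup 𝓘(ℝ, E_G) ∞ G] in
theorem continuous_tau10 : Continuous B.tau10 :=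
  (FiberBundle.continuous_proj (E_M →L[ℝ] E_P) (fun p : P =>
    (B.proj *ᵖ (TangentSpace 𝓘(ℝ, E_M) : M → Type _)) p →L[ℝ]
      (TangentSpace 𝓘(ℝ, E_P) p : Type _))).comp B.isEmbedding_incl.continuous

omit [LieGroup 𝓘(ℝ, E_G) ∞ G] in
theorem continuous_projC : Continuous B.projC :=
  (B.proj.contMDiff.continuous.comp continuous_tau10).quotient_lift _

variable [ChartedSpace (ModelJ1 E_M E_G) B.J1] [IsManifold 𝓘(ℝ, ModelJ1 E_M E_G) ∞ B.J1]
  (hi : IsSmoothEmbedding 𝓘(ℝ, ModelJ1 E_M E_G) (𝓘(ℝ, E_P).prod 𝓘(ℝ, E_M →L[ℝ] E_P)) ∞ B.incl)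
include hi

theorem isOpenQuotientMap_toC : IsOpenQuotientMap B.toC :=
  have : ContinuousConstSMul Gᵐᵒᵖ B.J1 :=
    ⟨fun a => (contMDiff_act_J1 hi).continuous.comp (Continuous.prodMk_left a.unop)⟩
  MulAction.isOpenQuotientMap_quotientMk

theorem exists_isEquivariantChart_J1 (ρ₀ : B.J1) :
    ∃ Θ : PartialDiffeomorph 𝓘(ℝ, ModelJ1 E_M E_G) (𝓘(ℝ, ModelC E_M E_G).prod 𝓘(ℝ, E_G))
      B.J1 (ModelC E_M E_G × G) ∞, ρ₀ ∈ Θ.source ∧ IsEquivariantChart Θ := by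
  have : Nonempty B.J1 := ⟨ρ₀⟩
  obtain ⟨U, φ, hU, hφ⟩ := B.isPrincipalBundle.exists_isTrivialization (B.tau1 ρ₀)
  let γ : B.J1 → G := (fun u => (φ u).2) ∘ B.tau10
  have hγ : IsGauge 𝓘(ℝ, ModelJ1 E_M E_G) 𝓘(ℝ, E_G) ∞ (B.tau10 ⁻¹' (B.proj ⁻¹' U)) γ :=
    (B.isPrincipalBundle.isGauge hφ).comp (contMDiff_tau10 hi) B.tau10_act
  let c : PartialDiffeomorph 𝓘(ℝ, E_M) 𝓘(ℝ, E_M) M E_M ∞ := chartDiffeomorph (B.tau1 ρ₀)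
  let k : PartialDiffeomorph 𝓘(ℝ, E_G) 𝓘(ℝ, E_G) G E_G ∞ := chartDiffeomorph 1
  let Ψ : PartialDiffeomorph 𝓘(ℝ, ModelJ1 E_M E_G) (𝓘(ℝ, ModelC E_M E_G).prod 𝓘(ℝ, E_G))
      B.J1 (ModelC E_M E_G × G) ∞ :=
    (((isAdapted_of_isTrivialization hφ c k).isSliceChart_incl.partialDiffeomorph hi).trans
      (orbitSplitting E_M E_G).toDiffeomorph.toPartialDiffeomorph).trans
    (prodSpace (Diffeomorph.refl 𝓘(ℝ, ModelC E_M E_G) (ModelC E_M E_G) ∞).toPartialDiffeomorph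
      k).symm
  have hΨ {ρ : B.J1} (hρφ : B.tau10 ρ ∈ φ.source) (hc : (φ (B.tau10 ρ)).1 ∈ c.source)
      (hk : (φ (B.tau10 ρ)).2 ∈ k.source) : ρ ∈ Ψ.source :=
    ⟨⟨⟨⟨hρφ, hc, hk⟩, mem_univ _⟩, mem_univ _⟩, mem_univ _, k.map_source hk⟩
  have hΨγ : ∀ ρ ∈ Ψ.source, (Ψ ρ).2 = (φ (B.tau10 ρ)).2 := fun ρ hρ =>
    k.left_inv hρ.1.1.1.2.2
  have hproj : B.proj (B.tau10 (gaugeFix γ ρ₀)) = B.tau1 ρ₀ := B.tau1_act ρ₀ _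
  have hρφ : B.tau10 (gaugeFix γ ρ₀) ∈ φ.source := by rwa [hφ.mem_source, hproj]
  have hρ₀ : gaugeFix γ ρ₀ ∈ Ψ.source := by
    refine hΨ hρφ ?_ ?_
    · rw [hφ.fst_eq _ hρφ, hproj]
      exact mem_extChartAt_source (B.tau1 ρ₀)
    · rw [show (φ (B.tau10 (gaugeFix γ ρ₀))).2 = 1 from hγ.apply_gaugeFix hU]
      exact mem_extChartAt_source 1
  exact ⟨hγ.equivariantChart (contMDiff_act_J1 hi) Ψ
    (fun ρ hρ => hφ.mem_source.1 hρ.1.1.1.1) hΨγ, ⟨hU, hρ₀⟩,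
    hγ.isEquivariantChart_equivariantChart (contMDiff_act_J1 hi) Ψ _ hΨγ⟩

theorem exists_isSubmersion_toC :
    ∃ _ : ChartedSpace (ModelC E_M E_G) B.C, IsManifold 𝓘(ℝ, ModelC E_M E_G) ∞ B.C ∧
      IsSubmersion 𝓘(ℝ, ModelJ1 E_M E_G) 𝓘(ℝ, ModelC E_M E_G) ∞ B.toC :=
  exists_isSubmersion_of_isEquivariantChart (by simp) (isOpenQuotientMap_toC hi) toC_eq_iff
    (exists_isEquivariantChart_J1 hi)

theorem secondCountableTopology_C [SecondCountableTopology B.J1] : SecondCountableTopology B.C :=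
  (isOpenQuotientMap_toC hi).isQuotientMap.secondCountableTopology
    (isOpenQuotientMap_toC hi).isOpenMap

variable [ChartedSpace (ModelC E_M E_G) B.C]
  (hq : IsSubmersion 𝓘(ℝ, ModelJ1 E_M E_G) 𝓘(ℝ, ModelC E_M E_G) ∞ B.toC)
include hq

theorem contMDiff_projC : ContMDiff 𝓘(ℝ, ModelC E_M E_G) 𝓘(ℝ, E_M) ∞ B.projC := fun y => by
  obtain ⟨ρ, rfl⟩ := (isOpenQuotientMap_toC hi).surjective y
  exact contMDiffAt_of_comp_isSubmersionAt (hq.isSubmersionAt ρ)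
    (B.proj.contMDiff.comp (contMDiff_tau10 hi) ρ)

theorem isSmoothOrbitMap_toC : IsSmoothOrbitMap (G := G) 𝓘(ℝ, ModelJ1 E_M E_G)
    𝓘(ℝ, ModelC E_M E_G) 𝓘(ℝ, E_G) B.toC where
  contMDiff_act := contMDiff_act_J1 hi
  contMDiff := hq.contMDiff
  apply_eq_iff := toC_eq_iff
  exists_localSection y := by
    obtain ⟨ρ, rfl⟩ := (isOpenQuotientMap_toC hi).surjective y
    obtain ⟨σ, hσ, -, hqσ⟩ := exists_localSection_of_isSubmersionAt (hq.isSubmersionAt ρ)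
    exact ⟨σ, hσ, hqσ⟩

theorem isPrincipalBundle_toC : IsPrincipalBundle (G := G) 𝓘(ℝ, ModelJ1 E_M E_G)
    𝓘(ℝ, ModelC E_M E_G) 𝓘(ℝ, E_G) B.toC :=
  (isSmoothOrbitMap_toC hi hq).isPrincipalBundle_of_equivariant B.isPrincipalBundle
    (contMDiff_tau10 hi) B.tau10_act (fun _ => rfl) continuous_projC

theorem t2Space_C [T2Space M] [T2Space B.J1] : T2Space B.C :=
  (isSmoothOrbitMap_toC hi hq).t2Space_of_equivariant B.isPrincipalBundle
    (contMDiff_tau10 hi) B.tau10_act (fun _ => rfl) continuous_projC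

end OrbitSpace

section Pullback

variable {E_M E_G E_P M G P : Type*}
  [NormedAddCommGroup E_M] [NormedSpace ℝ E_M] [NormedAddCommGroup E_G] [NormedSpace ℝ E_G]
  [NormedAddCommGroup E_P] [NormedSpace ℝ E_P]
  [TopologicalSpace M] [ChartedSpace E_M M]
  [TopologicalSpace G] [ChartedSpace E_G G] [Group G]
  [TopologicalSpace P] [ChartedSpace E_P P] [MulAction Gᵐᵒᵖ P]
  {B : PrincipalBundle E_M E_G E_P M G P}

section FiberProductCharts

variable {E_X H_X X F V W : Type*}
  [NormedAddCommGroup E_X] [NormedSpace ℝ E_X] [TopologicalSpace H_X]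
  {I_X : ModelWithCorners ℝ E_X H_X} [TopologicalSpace X] [ChartedSpace H_X X]
  [NormedAddCommGroup F] [NormedSpace ℝ F] [NormedAddCommGroup V] [NormedSpace ℝ V]
  [NormedAddCommGroup W] [NormedSpace ℝ W]
  {Q : PartialDiffeomorph 𝓘(ℝ, E_P) 𝓘(ℝ, W × V) P (W × V) ∞}
  {c : PartialDiffeomorph 𝓘(ℝ, E_M) 𝓘(ℝ, W) M W ∞}
  (κ : PartialDiffeomorph I_X 𝓘(ℝ, F) X F ∞) {f : X → M} (hf : ContMDiff I_X 𝓘(ℝ, E_M) ∞ f)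

/-- The linear map `(b, (w, v)) ↦ ((b, v), w)`, which moves the base coordinate `w` of a point of
`P` to the last place. -/
def baseLast (F W V : Type*) [NormedAddCommGroup F] [NormedSpace ℝ F] [NormedAddCommGroup V]
    [NormedSpace ℝ V] [NormedAddCommGroup W] [NormedSpace ℝ W] :
    (F × (W × V)) ≃L[ℝ] (F × V) × W :=
  ((ContinuousLinearEquiv.refl ℝ F).prodCongr (.prodComm ℝ W V)).trans
    (ContinuousLinearEquiv.prodAssoc ℝ F V W).symm

include hf in
theorem contDiffOn_comp_symm_fst : ContDiffOn ℝ ∞ (fun a : F × V => c (f (κ.symm a.1)))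
    {a | a.1 ∈ κ.target ∩ κ.symm ⁻¹' (f ⁻¹' c.source)} :=
  (c.contMDiffOn.comp (hf.comp_contMDiffOn (κ.symm.contMDiffOn.comp
    contDiff_fst.contMDiff.contMDiffOn fun _ ha => ha.1)) fun _ ha => ha.2).contDiffOn

omit [NormedSpace ℝ V] in
theorem isOpen_inter_preimage_symm_fst (hf : Continuous f) :
    IsOpen {a : F × V | a.1 ∈ κ.target ∩ κ.symm ⁻¹' (f ⁻¹' c.source)} :=
  (κ.symm.contMDiffOn.continuousOn.isOpen_inter_preimage κ.open_target
    (c.open_source.preimage hf)).preimage continuous_fst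

/-- A chart of `X × P` that straightens the fibre product `{(x, u) | f x = τ u}` to a slice: the
last coordinate is the base coordinate of `u` minus that of `f x`. -/
def fiberProductChart (Q : PartialDiffeomorph 𝓘(ℝ, E_P) 𝓘(ℝ, W × V) P (W × V) ∞)
    (c : PartialDiffeomorph 𝓘(ℝ, E_M) 𝓘(ℝ, W) M W ∞)
    (κ : PartialDiffeomorph I_X 𝓘(ℝ, F) X F ∞) (hf : ContMDiff I_X 𝓘(ℝ, E_M) ∞ f) :
    PartialDiffeomorph (I_X.prod 𝓘(ℝ, E_P)) 𝓘(ℝ, (F × V) × W) (X × P) ((F × V) × W) ∞ :=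
  ((prodSpace κ Q).trans (baseLast F W V).toDiffeomorph.toPartialDiffeomorph).trans
    (shear (isOpen_inter_preimage_symm_fst κ hf.continuous)
      (contDiffOn_comp_symm_fst (c := c) κ hf))

theorem mem_fiberProductChart_source {q : X × P} (hκ : q.1 ∈ κ.source) (hQ : q.2 ∈ Q.source)
    (hc : f q.1 ∈ c.source) : q ∈ (fiberProductChart Q c κ hf).source := by
  have hκq : κ.symm (κ q.1) = q.1 := κ.left_inv hκ
  exact ⟨⟨⟨hκ, hQ⟩, mem_univ _⟩, ⟨κ.map_source hκ, show f (κ.symm (κ q.1)) ∈ c.source from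
    hκq.symm ▸ hc⟩, mem_univ _⟩

theorem IsAdapted.snd_fiberProductChart_eq_zero_iff (h : B.IsAdapted Q c) {q : X × P}
    (hq : q ∈ (fiberProductChart Q c κ hf).source) :
    (fiberProductChart Q c κ hf q).2 = 0 ↔ f q.1 = B.proj q.2 := by
  obtain ⟨⟨⟨hκ, hQ⟩, -⟩, ⟨-, hc⟩, -⟩ := hq
  have hκq : κ.symm (κ q.1) = q.1 := κ.left_inv hκ
  have hc : f (κ.symm (κ q.1)) ∈ c.source := hc
  have hchart : (fiberProductChart Q c κ hf q).2 = (Q q.2).1 - c (f (κ.symm (κ q.1))) := rfl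
  rw [hκq] at hc hchart
  rw [hchart, h.fst_eq _ hQ, sub_eq_zero, c.injOn.eq_iff (h.proj_mem _ hQ) hc]
  exact eq_comm

end FiberProductCharts

section PullbackBundle

variable [IsManifold 𝓘(ℝ, E_M) ∞ M] [IsManifold 𝓘(ℝ, E_P) ∞ P]

theorem isEmbedding_pullbackIncl : IsEmbedding B.pullbackIncl :=
  IsEmbedding.subtypeVal

theorem mem_range_pullbackIncl {q : B.C × P} :
    q ∈ range B.pullbackIncl ↔ B.projC q.1 = B.proj q.2 :=
  ⟨fun ⟨a, ha⟩ => ha ▸ a.2, fun hq => ⟨⟨q, hq⟩, rfl⟩⟩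

theorem toPullback_act (ρ : B.J1) (g : G) : B.toPullback (ρ <• g) = B.toPullback ρ <• g :=
  Subtype.ext (Prod.ext ((toC_eq_iff ρ _).2 ⟨g, rfl⟩).symm rfl)

theorem pullbackProj_eq_iff (q q' : B.Pullback) :
    B.pullbackProj q = B.pullbackProj q' ↔ ∃ g : G, q <• g = q' := by
  refine ⟨fun h => ?_, fun ⟨_, hg⟩ => hg ▸ rfl⟩
  obtain ⟨g, hg⟩ := B.isPrincipalBundle.proj_eq_iff.1
    ((q.2.symm.trans (congrArg B.projC h)).trans q'.2)
  exact ⟨g, Subtype.ext (Prod.ext h hg)⟩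

variable [ChartedSpace (ModelC E_M E_G) B.C]

theorem exists_isSmoothEmbedding_pullbackIncl [IsManifold 𝓘(ℝ, E_G) ∞ G]
    [IsManifold 𝓘(ℝ, ModelC E_M E_G) ∞ B.C]
    (hp : ContMDiff 𝓘(ℝ, ModelC E_M E_G) 𝓘(ℝ, E_M) ∞ B.projC) :
    ∃ _ : ChartedSpace (ModelJ1 E_M E_G) B.Pullback,
      IsManifold 𝓘(ℝ, ModelJ1 E_M E_G) ∞ B.Pullback ∧
      IsSmoothEmbedding 𝓘(ℝ, ModelJ1 E_M E_G) (𝓘(ℝ, ModelC E_M E_G).prod 𝓘(ℝ, E_P)) ∞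
        B.pullbackIncl := by
  refine exists_isSmoothEmbedding_of_isSliceChart (K := E_M) (by simp)
    isEmbedding_pullbackIncl fun a => ?_
  obtain ⟨Q, c, hQ, h⟩ := B.exists_isAdapted (B.pullbackIncl a).2
  let κ : PartialDiffeomorph 𝓘(ℝ, ModelC E_M E_G) 𝓘(ℝ, ModelC E_M E_G) B.C (ModelC E_M E_G) ∞ :=
    chartDiffeomorph (B.pullbackIncl a).1
  have hc : B.projC (B.pullbackIncl a).1 ∈ c.source :=
    (show B.projC (B.pullbackIncl a).1 = B.proj (B.pullbackIncl a).2 from a.2) ▸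
      h.proj_mem _ hQ
  refine ⟨(fiberProductChart Q c κ hp).trans
    ((orbitSplitting E_M E_G).symm.prodCongr
      (.refl ℝ E_M)).toDiffeomorph.toPartialDiffeomorph,
    ⟨mem_fiberProductChart_source κ hp (mem_extChartAt_source _) hQ hc, mem_univ _⟩,
    fun q hq => ?_⟩
  rw [mem_range_pullbackIncl, ← h.snd_fiberProductChart_eq_zero_iff κ hp hq.1]
  rfl

variable [ChartedSpace (ModelJ1 E_M E_G) B.Pullback]
  (hj : IsSmoothEmbedding 𝓘(ℝ, ModelJ1 E_M E_G)
    (𝓘(ℝ, ModelC E_M E_G).prod 𝓘(ℝ, E_P)) ∞ B.pullbackIncl)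
include hj

theorem contMDiff_act_pullback :
    ContMDiff (𝓘(ℝ, ModelJ1 E_M E_G).prod 𝓘(ℝ, E_G)) 𝓘(ℝ, ModelJ1 E_M E_G) ∞
      fun q : B.Pullback × G => q.1 <• q.2 := by
  have hincl : ContMDiff (𝓘(ℝ, ModelJ1 E_M E_G).prod 𝓘(ℝ, E_G))
      (𝓘(ℝ, ModelC E_M E_G).prod 𝓘(ℝ, E_P)) ∞ fun q : B.Pullback × G => B.pullbackIncl q.1 :=
    hj.isImmersion.contMDiff.comp contMDiff_fst
  exact (contMDiff_iff_comp_isSmoothEmbedding hj).2 ((contMDiff_fst.comp hincl).prodMk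
    (B.isPrincipalBundle.contMDiff_act.comp ((contMDiff_snd.comp hincl).prodMk contMDiff_snd)))

theorem exists_localSection_pullbackProj
    (hp : ContMDiff 𝓘(ℝ, ModelC E_M E_G) 𝓘(ℝ, E_M) ∞ B.projC) (y : B.C) :
    ∃ σ : B.C → B.Pullback,
      ContMDiffAt 𝓘(ℝ, ModelC E_M E_G) 𝓘(ℝ, ModelJ1 E_M E_G) ∞ σ y ∧
      ∀ᶠ z in 𝓝 y, B.pullbackProj (σ z) = z := by
  obtain ⟨s, hs, hτs⟩ := B.isPrincipalBundle.exists_localSection (B.projC y)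
  have hτs : ∀ᶠ z in 𝓝 y, B.proj (s (B.projC z)) = B.projC z :=
    hp.continuous.continuousAt.eventually hτs
  have : Nonempty B.Pullback := ⟨⟨(y, s (B.projC y)), hτs.self_of_nhds.symm⟩⟩
  let σ : B.C → B.Pullback := fun z => invFun B.pullbackIncl (z, s (B.projC z))
  have hσ : ∀ᶠ z in 𝓝 y, B.pullbackIncl (σ z) = (z, s (B.projC z)) :=
    hτs.mono fun z hz => invFun_eq (mem_range_pullbackIncl.2 hz.symm)
  have hsmooth : ContMDiffAt 𝓘(ℝ, ModelC E_M E_G) (𝓘(ℝ, ModelC E_M E_G).prod 𝓘(ℝ, E_P)) ∞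
      (fun z => (z, s (B.projC z))) y :=
    contMDiffAt_id.prodMk (hs.comp y hp.contMDiffAt)
  exact ⟨σ, (contMDiffAt_iff_comp_isSmoothEmbedding hj).2 (hsmooth.congr_of_eventuallyEq hσ),
    hσ.mono fun z hz => congrArg Prod.fst hz⟩

theorem isPrincipalBundle_pullbackProj [LieGroup 𝓘(ℝ, E_G) ∞ G]
    (hp : ContMDiff 𝓘(ℝ, ModelC E_M E_G) 𝓘(ℝ, E_M) ∞ B.projC) :
    IsPrincipalBundle (G := G) 𝓘(ℝ, ModelJ1 E_M E_G) 𝓘(ℝ, ModelC E_M E_G) 𝓘(ℝ, E_G)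
      B.pullbackProj :=
  IsSmoothOrbitMap.isPrincipalBundle_of_equivariant
    ⟨contMDiff_act_pullback hj, contMDiff_fst.comp hj.isImmersion.contMDiff, pullbackProj_eq_iff,
      exists_localSection_pullbackProj hj hp⟩
    B.isPrincipalBundle (contMDiff_snd.comp hj.isImmersion.contMDiff) (fun _ _ => rfl)
    (fun q => q.2) hp.continuous

theorem isPrincipalBundleIso_toPullback [LieGroup 𝓘(ℝ, E_G) ∞ G]
    [ChartedSpace (ModelJ1 E_M E_G) B.J1] [IsManifold 𝓘(ℝ, ModelJ1 E_M E_G) ∞ B.J1]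
    (hi : IsSmoothEmbedding 𝓘(ℝ, ModelJ1 E_M E_G)
      (𝓘(ℝ, E_P).prod 𝓘(ℝ, E_M →L[ℝ] E_P)) ∞ B.incl)
    (hq : IsSubmersion 𝓘(ℝ, ModelJ1 E_M E_G) 𝓘(ℝ, ModelC E_M E_G) ∞ B.toC) :
    IsPrincipalBundleIso G 𝓘(ℝ, ModelJ1 E_M E_G) 𝓘(ℝ, ModelJ1 E_M E_G) B.toC B.pullbackProj
      B.toPullback :=
  (isPrincipalBundle_toC hi hq).isPrincipalBundleIso_of_equivariant
    (isPrincipalBundle_pullbackProj hj (contMDiff_projC hi hq))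
    ((contMDiff_iff_comp_isSmoothEmbedding hj).2 (hq.contMDiff.prodMk (contMDiff_tau10 hi)))
    toPullback_act fun _ => rfl

end PullbackBundle

end Pullback

section LocalSections

variable {E_M E_G E_P M G P : Type*}
  [NormedAddCommGroup E_M] [NormedSpace ℝ E_M] [NormedAddCommGroup E_G] [NormedSpace ℝ E_G]
  [NormedAddCommGroup E_P] [NormedSpace ℝ E_P]
  [TopologicalSpace M] [ChartedSpace E_M M]
  [TopologicalSpace G] [ChartedSpace E_G G] [Group G]
  [TopologicalSpace P] [ChartedSpace E_P P] [MulAction Gᵐᵒᵖ P]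
  {B : PrincipalBundle E_M E_G E_P M G P}
  {V W : Type*} [NormedAddCommGroup V] [NormedSpace ℝ V] [NormedAddCommGroup W] [NormedSpace ℝ W]
  {Q : PartialDiffeomorph 𝓘(ℝ, E_P) 𝓘(ℝ, W × V) P (W × V) ∞}
  {c : PartialDiffeomorph 𝓘(ℝ, E_M) 𝓘(ℝ, W) M W ∞}

/-- The map `M → P` which in adapted charts `Q`, `c` is affine with value `y.1` at the base point
`y.1.1` and linear part `y.2`. -/
def affineSection (Q : PartialDiffeomorph 𝓘(ℝ, E_P) 𝓘(ℝ, W × V) P (W × V) ∞)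
    (c : PartialDiffeomorph 𝓘(ℝ, E_M) 𝓘(ℝ, W) M W ∞) (y : (W × V) × (W →L[ℝ] W × V)) (x : M) : P :=
  Q.symm (y.1 + y.2 (c x - y.1.1))

variable {y : (W × V) × (W →L[ℝ] W × V)}

theorem IsAdapted.proj_symm_mem (h : B.IsAdapted Q c) {v : W × V} (hv : v ∈ Q.target) :
    B.proj (Q.symm v) ∈ c.source :=
  h.proj_mem _ (Q.map_target hv)

theorem IsAdapted.apply_proj_symm (h : B.IsAdapted Q c) {v : W × V} (hv : v ∈ Q.target) :
    c (B.proj (Q.symm v)) = v.1 :=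
  (h.fst_eq _ (Q.map_target hv)).symm.trans
    (congrArg Prod.fst (show Q (Q.symm v) = v from Q.right_inv hv))

theorem IsAdapted.affineSection_proj_symm (h : B.IsAdapted Q c) (hy : y.1 ∈ Q.target) :
    affineSection Q c y (B.proj (Q.symm y.1)) = Q.symm y.1 := by
  rw [affineSection, h.apply_proj_symm hy, sub_self, map_zero, add_zero]

theorem IsAdapted.isLocalSectionAt_affineSection (h : B.IsAdapted Q c) (hy : y.1 ∈ Q.target)
    (hfst : ContinuousLinearMap.fst ℝ W V ∘L y.2 = .id ℝ W) :
    B.IsLocalSectionAt (affineSection Q c y) (B.proj (Q.symm y.1)) := by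
  let a : M → W × V := fun x => y.1 + y.2 (c x - y.1.1)
  have ha : ContMDiffOn 𝓘(ℝ, E_M) 𝓘(ℝ, W × V) ∞ a c.source :=
    (show ContDiff ℝ ∞ fun w => y.1 + y.2 (w - y.1.1) by fun_prop).contMDiff.comp_contMDiffOn
      c.contMDiffOn
  have hbase : a (B.proj (Q.symm y.1)) = y.1 := by
    simp only [a, h.apply_proj_symm hy, sub_self, map_zero, add_zero]
  refine ⟨c.source ∩ a ⁻¹' Q.target,
    ha.continuousOn.isOpen_inter_preimage c.open_source Q.open_target,
    ⟨h.proj_symm_mem hy, mem_preimage.2 (hbase.symm ▸ hy)⟩,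
    Q.symm.contMDiffOn.comp (ha.mono inter_subset_left) fun _ hx => hx.2, fun x hx => ?_⟩
  refine c.injOn (h.proj_symm_mem hx.2) hx.1 ((h.apply_proj_symm hx.2).trans ?_)
  have hlin : (y.2 (c x - y.1.1)).1 = c x - y.1.1 := congr($hfst (c x - y.1.1))
  rw [Prod.fst_add, hlin, add_sub_cancel]

theorem IsAdapted.mfderiv_affineSection (h : B.IsAdapted Q c) (hy : y.1 ∈ Q.target) :
    (mfderiv 𝓘(ℝ, E_M) 𝓘(ℝ, E_P) (affineSection Q c y) (B.proj (Q.symm y.1)) : E_M →L[ℝ] E_P) =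
      (mfderiv 𝓘(ℝ, W × V) 𝓘(ℝ, E_P) Q.symm y.1 : W × V →L[ℝ] E_P) ∘L y.2 ∘L
        (mfderiv 𝓘(ℝ, E_M) 𝓘(ℝ, W) c (B.proj (Q.symm y.1)) : E_M →L[ℝ] W) := by
  let a : W → W × V := fun w => y.1 + y.2 (w - y.1.1)
  let x := B.proj (Q.symm y.1)
  have hcx : c x = y.1.1 := h.apply_proj_symm hy
  have hax : a (c x) = y.1 := by simp only [a, hcx, sub_self, map_zero, add_zero]
  have ha : HasMFDerivAt 𝓘(ℝ, W) 𝓘(ℝ, W × V) a (c x) y.2 :=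
    ((y.2.hasFDerivAt.comp _ ((hasFDerivAt_id _).sub_const _)).const_add _).hasMFDerivAt
  have hc : HasMFDerivAt 𝓘(ℝ, E_M) 𝓘(ℝ, W) c x (mfderiv 𝓘(ℝ, E_M) 𝓘(ℝ, W) c x) :=
    ((contMDiffAt_of_mem_source c (h.proj_symm_mem hy)).mdifferentiableAt (by simp)).hasMFDerivAt
  have hQ : HasMFDerivAt 𝓘(ℝ, W × V) 𝓘(ℝ, E_P) Q.symm (a (c x))
      (mfderiv 𝓘(ℝ, W × V) 𝓘(ℝ, E_P) Q.symm y.1) :=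
    hax ▸ ((contMDiffAt_symm_of_mem_target Q hy).mdifferentiableAt (by simp)).hasMFDerivAt
  exact (hQ.comp (f := a ∘ c) x (ha.comp x hc)).mfderiv

theorem IsAdapted.incl_jet_affineSection (h : B.IsAdapted Q c) (hy : y.1 ∈ Q.target)
    (hfst : ContinuousLinearMap.fst ℝ W V ∘L y.2 = .id ℝ W) :
    B.incl (B.jet _ _ (h.isLocalSectionAt_affineSection hy hfst)) = B.homCoordSymm Q c y :=
  TotalSpace.ext (h.affineSection_proj_symm hy) (heq_of_eq (h.mfderiv_affineSection hy))

theorem exists_jet_eq (B : PrincipalBundle E_M E_G E_P M G P) [IsManifold 𝓘(ℝ, E_M) ∞ M]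
    [IsManifold 𝓘(ℝ, E_G) ∞ G] (ρ : B.J1) :
    ∃ (s : M → P) (x : M) (hs : B.IsLocalSectionAt s x), B.jet s x hs = ρ := by
  obtain ⟨Q, c, hQ, h⟩ := B.exists_isAdapted (B.tau10 ρ)
  have hy : (B.homCoord Q c (B.incl ρ)).1 ∈ Q.target := Q.map_source hQ
  have hfst := (h.fst_comp_homCoord_eq_id_iff (η := B.incl ρ) hQ).2 ρ.2
  exact ⟨_, _, h.isLocalSectionAt_affineSection hy hfst, Subtype.ext
    ((h.incl_jet_affineSection hy hfst).trans (B.homCoordSymm_homCoord hQ (h.proj_mem _ hQ)))⟩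

end LocalSections

end PrincipalBundle

end

theorem mainTheorem9_general
    {E_M E_G E_P : Type*}
    [NormedAddCommGroup E_M] [NormedSpace ℝ E_M]
    [NormedAddCommGroup E_G] [NormedSpace ℝ E_G]
    [NormedAddCommGroup E_P] [NormedSpace ℝ E_P]
    [SecondCountableTopology (E_M →L[ℝ] E_P)]
    {M G P : Type*}
    [TopologicalSpace M] [T2Space M] [ChartedSpace E_M M] [IsManifold 𝓘(ℝ, E_M) ∞ M]
    [TopologicalSpace G] [ChartedSpace E_G G] [Group G] [LieGroup 𝓘(ℝ, E_G) ∞ G]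
    [TopologicalSpace P] [T2Space P] [SecondCountableTopology P]
    [ChartedSpace E_P P] [IsManifold 𝓘(ℝ, E_P) ∞ P] [MulAction Gᵐᵒᵖ P]
    (B : PrincipalBundle E_M E_G E_P M G P) :
    (T2Space B.J1 ∧ SecondCountableTopology B.J1 ∧ T2Space B.C ∧ SecondCountableTopology B.C) ∧
    (∃ (_ : ChartedSpace (PrincipalBundle.ModelJ1 E_M E_G) B.J1)
      (_ : ChartedSpace (PrincipalBundle.ModelC E_M E_G) B.C)
      (_ : ChartedSpace (PrincipalBundle.ModelJ1 E_M E_G) B.Pullback),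
      B.IsStandardSmoothStructure) ∧
    (∀ ρ : B.J1, ∃ (s : M → P) (x : M) (hs : B.IsLocalSectionAt s x), B.jet s x hs = ρ) ∧
    ∀ [ChartedSpace (PrincipalBundle.ModelJ1 E_M E_G) B.J1]
      [ChartedSpace (PrincipalBundle.ModelC E_M E_G) B.C]
      [ChartedSpace (PrincipalBundle.ModelJ1 E_M E_G) B.Pullback],
      B.IsStandardSmoothStructure →
      IsPrincipalBundle (G := G) 𝓘(ℝ, PrincipalBundle.ModelJ1 E_M E_G)
        𝓘(ℝ, PrincipalBundle.ModelC E_M E_G) 𝓘(ℝ, E_G) B.toC ∧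
      ContMDiff 𝓘(ℝ, PrincipalBundle.ModelC E_M E_G) 𝓘(ℝ, E_M) ∞ B.projC ∧
      IsPrincipalBundle (G := G) 𝓘(ℝ, PrincipalBundle.ModelJ1 E_M E_G)
        𝓘(ℝ, PrincipalBundle.ModelC E_M E_G) 𝓘(ℝ, E_G) B.pullbackProj ∧
      IsPrincipalBundleIso G 𝓘(ℝ, PrincipalBundle.ModelJ1 E_M E_G)
        𝓘(ℝ, PrincipalBundle.ModelJ1 E_M E_G) B.toC B.pullbackProj B.toPullback ∧
      ∀ (s : M → P) (x : M) (hs : B.IsLocalSectionAt s x),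
        B.pullbackIncl (B.toPullback (B.jet s x hs)) = (B.toC (B.jet s x hs), s x) := by
  obtain ⟨_, hJ, hi⟩ := B.exists_isSmoothEmbedding_incl
  have := B.t2Space_J1
  have := B.secondCountableTopology_J1
  obtain ⟨_, hC, hq⟩ := PrincipalBundle.exists_isSubmersion_toC hi
  refine ⟨⟨‹_›, ‹_›, PrincipalBundle.t2Space_C hi hq, PrincipalBundle.secondCountableTopology_C hi⟩,
    ?_, B.exists_jet_eq, ?_⟩
  · obtain ⟨_, hP, hj⟩ := PrincipalBundle.exists_isSmoothEmbedding_pullbackIncl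
      (PrincipalBundle.contMDiff_projC hi hq)
    exact ⟨_, _, _, hJ, hC, hP, hi, hq, hj⟩
  · intro _ _ _ h
    have := h.isManifold_J1
    have hi := h.isSmoothEmbedding_incl
    have hq := h.isSubmersion_toC
    have hj := h.isSmoothEmbedding_pullbackIncl
    have hp := PrincipalBundle.contMDiff_projC hi hq
    exact ⟨PrincipalBundle.isPrincipalBundle_toC hi hq, hp,
      PrincipalBundle.isPrincipalBundle_pullbackProj hj hp,
      PrincipalBundle.isPrincipalBundleIso_toPullback hj hi hq, fun _ _ _ => rfl⟩

theorem mainTheorem9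
    {E_M E_G E_P : Type*}
    [NormedAddCommGroup E_M] [NormedSpace ℝ E_M] [FiniteDimensional ℝ E_M]
    [NormedAddCommGroup E_G] [NormedSpace ℝ E_G] [FiniteDimensional ℝ E_G]
    [NormedAddCommGroup E_P] [NormedSpace ℝ E_P] [FiniteDimensional ℝ E_P]
    {M G P : Type*}
    [TopologicalSpace M] [T2Space M] [SecondCountableTopology M]
    [ChartedSpace E_M M] [IsManifold 𝓘(ℝ, E_M) ∞ M]
    [TopologicalSpace G] [T2Space G] [SecondCountableTopology G]
    [ChartedSpace E_G G] [Group G] [LieGroup 𝓘(ℝ, E_G) ∞ G]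
    [TopologicalSpace P] [T2Space P] [SecondCountableTopology P]
    [ChartedSpace E_P P] [IsManifold 𝓘(ℝ, E_P) ∞ P] [MulAction Gᵐᵒᵖ P]
    (B : PrincipalBundle E_M E_G E_P M G P) :
    -- `J¹P` and `J¹P/G` are Hausdorff and second countable, and (with `p^*P`) smooth manifolds
    (T2Space B.J1 ∧ SecondCountableTopology B.J1 ∧ T2Space B.C ∧ SecondCountableTopology B.C) ∧
    (∃ (_ : ChartedSpace (PrincipalBundle.ModelJ1 E_M E_G) B.J1)
      (_ : ChartedSpace (PrincipalBundle.ModelC E_M E_G) B.C)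
      (_ : ChartedSpace (PrincipalBundle.ModelJ1 E_M E_G) B.Pullback),
      B.IsStandardSmoothStructure) ∧
    -- the points of `J¹P` are the `1`-jets of local sections
    (∀ ρ : B.J1, ∃ (s : M → P) (x : M) (hs : B.IsLocalSectionAt s x), B.jet s x hs = ρ) ∧
    ∀ [ChartedSpace (PrincipalBundle.ModelJ1 E_M E_G) B.J1]
      [ChartedSpace (PrincipalBundle.ModelC E_M E_G) B.C]
      [ChartedSpace (PrincipalBundle.ModelJ1 E_M E_G) B.Pullback],
      B.IsStandardSmoothStructure →
      -- `p_G : J¹P → J¹P/G` is a principal `G`-bundle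
      IsPrincipalBundle (G := G) 𝓘(ℝ, PrincipalBundle.ModelJ1 E_M E_G)
        𝓘(ℝ, PrincipalBundle.ModelC E_M E_G) 𝓘(ℝ, E_G) B.toC ∧
      -- `p : J¹P/G → M` is smooth, and `p₁ : p^*P → J¹P/G` is a principal `G`-bundle
      ContMDiff 𝓘(ℝ, PrincipalBundle.ModelC E_M E_G) 𝓘(ℝ, E_M) ∞ B.projC ∧
      IsPrincipalBundle (G := G) 𝓘(ℝ, PrincipalBundle.ModelJ1 E_M E_G)
        𝓘(ℝ, PrincipalBundle.ModelC E_M E_G) 𝓘(ℝ, E_G) B.pullbackProj ∧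
      -- `j¹_x s ↦ ([j¹_x s]_G, s(x))` is an isomorphism of principal `G`-bundles
      IsPrincipalBundleIso G 𝓘(ℝ, PrincipalBundle.ModelJ1 E_M E_G)
        𝓘(ℝ, PrincipalBundle.ModelJ1 E_M E_G) B.toC B.pullbackProj B.toPullback ∧
      ∀ (s : M → P) (x : M) (hs : B.IsLocalSectionAt s x),
        B.pullbackIncl (B.toPullback (B.jet s x hs)) = (B.toC (B.jet s x hs), s x) := by
  have : ProperSpace (E_M →L[ℝ] E_P) := FiniteDimensional.proper ℝ _
  exact mainTheorem9_general B
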